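/- Let $1\le p<\infty$ and let $q\in(1,\infty]$ be its Hölder conjugate, $\frac1p+\frac1q=1$. For a real random variable $Y$ put $$\|Y\|_{\psi_2}=\inf\{t>0:\ \mathbb E\exp(|Y|^2/t^2)\le 2\}\in[0,\infty]\qquad(\inf\emptyset=\infty),$$ and call $Y$ sub-Gaussian if $\|Y\|_{\psi_2}<\infty$. Let $\|\cdot\|_r$ denote the $\ell_r$ norm, and set $B_q^m=\{z\in\mathbb R^m:\|z\|_q\le 1\}$ and $\operatorname{rad}(S)=\sup_{y\in S}\|y\|_2$ for $S\subseteq\mathbb R^m$. There is a constant $C_p\in(0,\infty)$, depending only on $p$, such that the following holds for all integers $m,n\ge 1$. Let $A=(A_{i,j})$ be an $m\times n$ random matrix with i.i.d. mean-zero, unit-variance, sub-Gaussian real entries, let $K=\|A_{1,1}\|_{\psi_2}$, and let $A_1$ be the first row of $A$. For $x\in\mathbb R^n$ put $$R_x=\|Ax\|_p-m^{1/p}\big(\mathbb E|\langle A_1,x\rangle|^p\big)^{1/p},\qquad X_x=\|Ax\|_p-\mathbb E\|Ax\|_p .$$ Then, for every $x\in\mathbb R^n$, $$\|R_x\|_{\psi_2}\le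 C_pK^{4p}\operatorname{rad}(B_q^m)\,\|x\|_2\qquad\text{and}\qquad \|X_x\|_{\psi_2}\le C_pK^{4p}\operatorname{rad}(B_q^m)\,\|x\|_2 .$$ -/

import Mathlib

open MeasureTheory ProbabilityTheory
open scoped ENNReal NNReal Matrix

noncomputable section

namespace MatrixDeviation

/-- The `α`-Orlicz norm of a real random variable,
`inf {t > 0 : 𝔼 exp(|X|^α / t^α) ≤ 2}`, with values in `[0, ∞]`, so that `inf ∅ = ∞`. -/
def orliczNorm {Ω : Type*} [MeasurableSpace Ω] (α : ℝ) (X : Ω → ℝ) (μ : Measure Ω) : ℝ≥0∞ :=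
  sInf {s : ℝ≥0∞ | ∃ t : ℝ, 0 < t ∧ s = ENNReal.ofReal t ∧
    ∫⁻ ω, ENNReal.ofReal (Real.exp (|X ω| ^ α / t ^ α)) ∂μ ≤ 2}

/-- The `ℓ_p` norm on `ℝ^m`, for `1 ≤ p ≤ ∞`. -/
def ellNorm {m : ℕ} (p : ℝ≥0∞) (z : Fin m → ℝ) : ℝ :=
  ‖(WithLp.toLp p z : PiLp p fun _ : Fin m => ℝ)‖

/-- The closed unit ball `B_q^m` of the `ℓ_q` norm on `ℝ^m`. -/
def ellBall (q : ℝ≥0∞) (m : ℕ) : Set (Fin m → ℝ) :=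
  {z | ellNorm q z ≤ 1}

/-- The radius `rad(S) = sup_{y ∈ S} ‖y‖₂`. -/
def rad {m : ℕ} (S : Set (Fin m → ℝ)) : ℝ≥0∞ :=
  ⨆ y ∈ S, ENNReal.ofReal (ellNorm 2 y)

/-- `A` is an `m × n` random matrix with i.i.d., mean-zero, unit-variance, sub-Gaussian entries. -/
structure IsSubGaussianEnsemble {Ω : Type*} [MeasurableSpace Ω] {m n : ℕ}
    (A : Ω → Matrix (Fin m) (Fin n) ℝ) (μ : Measure Ω) : Prop where
  measurable : ∀ i j, Measurable fun ω => A ω i j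
  indep : iIndepFun (fun (ij : Fin m × Fin n) ω => A ω ij.1 ij.2) μ
  identDistrib : ∀ i j i' j', IdentDistrib (fun ω => A ω i j) (fun ω => A ω i' j') μ μ
  mean_zero : ∀ i j, ∫ ω, A ω i j ∂μ = 0
  unit_variance : ∀ i j, variance (fun ω => A ω i j) μ = 1
  subGaussian : ∀ i j, orliczNorm 2 (fun ω => A ω i j) μ < ∞

/-- `‖A₁ x‖_{L^p} = (𝔼 |⟨A₁, x⟩|^p)^{1/p}`, where `A₁` is the first row of `A`.
(For a sub-Gaussian ensemble the integrand is integrable.) -/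
def rowNorm {Ω : Type*} [MeasurableSpace Ω] {m n : ℕ} [NeZero m] (p : ℝ)
    (A : Ω → Matrix (Fin m) (Fin n) ℝ) (μ : Measure Ω) (x : Fin n → ℝ) : ℝ :=
  (∫ ω, |A ω 0 ⬝ᵥ x| ^ p ∂μ) ^ (1 / p)

/-- The process `R_x = ‖A x‖_p - m^{1/p} ‖A₁ x‖_{L^p}`. -/
def processR {Ω : Type*} [MeasurableSpace Ω] {m n : ℕ} [NeZero m] (p : ℝ)
    (A : Ω → Matrix (Fin m) (Fin n) ℝ) (μ : Measure Ω) (x : Fin n → ℝ) (ω : Ω) : ℝ :=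
  ellNorm (ENNReal.ofReal p) (A ω *ᵥ x) - (m : ℝ) ^ (1 / p) * rowNorm p A μ x

/-- The process `X_x = ‖A x‖_p - 𝔼 ‖A x‖_p`.
(For a sub-Gaussian ensemble the integrand is integrable.) -/
def processX {Ω : Type*} [MeasurableSpace Ω] {m n : ℕ} (p : ℝ)
    (A : Ω → Matrix (Fin m) (Fin n) ℝ) (μ : Measure Ω) (x : Fin n → ℝ) (ω : Ω) : ℝ :=
  ellNorm (ENNReal.ofReal p) (A ω *ᵥ x) -
    ∫ ω', ellNorm (ENNReal.ofReal p) (A ω' *ᵥ x) ∂μ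

end MatrixDeviation

end

/-! For `x ≠ 0`, the products `⟨A_i, x⟩` are i.i.d. with second moment `‖x‖₂²`, and they satisfy a
`ψ₂` bound at scale `L = 8K‖x‖₂`. Put `W_i = |⟨A_i, x⟩| / L`, so that `𝔼 exp (W_i²) ≤ 2` and `𝔼
W_i^p = s^p`. The claim becomes concentration of `‖W‖_p` about `b = m^(1/p) s` at scale `r = max 1
(m^(1/p - 1/2))`, a lower bound for `rad (B_q^m)`.

A deviation `t r` of the norm forces a deviation of at least `b^(p-1) t r` in `∑ W_i^p`, and
`b^(p-1) r ≥ s^(p-1) √m`. This is `t` times the natural fluctuation of the sum, up to the factor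
`s^(p-1)`. Chernoff's bound gives Gaussian decay for the lower tail at every `t`
(`measure_lower_tail_le`). Large upper deviations need more: for `p ≤ 2`, comparison with the `ℓ₂`
norm (`measure_upper_tail_le_of_le_two`); for `p ≥ 2`, truncation of the powers and a union bound
over large coordinates (`measure_upper_tail_le_of_two_le`).

The loss `s^(-(p-1))` is controlled from below by the first moment: a fixed second moment and a `ψ₂`
bound force `s` to be at least a multiple of `K^(-3)` (`HasPsiTwoBound.le_integral_abs`,
`le_rowNorm_div`). Together `L` and this loss cost `K^(3p-2)`, which is at most `K^(4p)` because
unit variance gives `K ≥ 1`. The process `X_x` is `R_x` minus its mean, and centering costs a factor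
3. -/

namespace MatrixDeviation

variable {Ω : Type*} [MeasurableSpace Ω] {μ : Measure Ω}

/-! ### The `ψ₂` condition: rescaling, Gaussian tails, centering -/

/-- `𝔼 exp (X² / T²) ≤ 2`, with an integrable integrand. -/
structure HasPsiTwoBound (X : Ω → ℝ) (T : ℝ) (μ : Measure Ω) : Prop where
  integrable : Integrable (fun ω => Real.exp (X ω ^ 2 / T ^ 2)) μ
  integral_le : ∫ ω, Real.exp (X ω ^ 2 / T ^ 2) ∂μ ≤ 2

lemma abs_rpow_two_div (x t : ℝ) : |x| ^ (2 : ℝ) / t ^ (2 : ℝ) = x ^ 2 / t ^ 2 := by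
  rw [Real.rpow_two, Real.rpow_two, sq_abs]

lemma hasPsiTwoBound_iff_lintegral {X : Ω → ℝ} (hX : AEMeasurable X μ) {T : ℝ} :
    HasPsiTwoBound X T μ ↔ ∫⁻ ω, ENNReal.ofReal (Real.exp (X ω ^ 2 / T ^ 2)) ∂μ ≤ 2 := by
  have hm : AEStronglyMeasurable (fun ω => Real.exp (X ω ^ 2 / T ^ 2)) μ :=
    (Real.measurable_exp.comp_aemeasurable ((hX.pow_const 2).div_const _)).aestronglyMeasurable
  have h0 : ∀ ω, 0 ≤ Real.exp (X ω ^ 2 / T ^ 2) := fun ω => (Real.exp_pos _).le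
  constructor
  · intro h
    rw [← ofReal_integral_eq_lintegral_ofReal h.integrable (Filter.Eventually.of_forall h0)]
    simpa using ENNReal.ofReal_le_ofReal h.integral_le
  · intro h
    have hi : Integrable (fun ω => Real.exp (X ω ^ 2 / T ^ 2)) μ :=
      ⟨hm, by
        rw [hasFiniteIntegral_iff_ofReal (Filter.Eventually.of_forall h0)]
        exact h.trans_lt (by simp)⟩
    refine ⟨hi, ?_⟩
    rw [integral_eq_lintegral_of_nonneg_ae (Filter.Eventually.of_forall h0) hm]
    exact ENNReal.toReal_le_of_le_ofReal (by norm_num) (by simpa using h)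

lemma HasPsiTwoBound.orliczNorm_le {X : Ω → ℝ} {T : ℝ} (hT : 0 < T) (hX : AEMeasurable X μ)
    (h : HasPsiTwoBound X T μ) : orliczNorm 2 X μ ≤ ENNReal.ofReal T := by
  refine sInf_le ⟨T, hT, rfl, ?_⟩
  simpa only [abs_rpow_two_div] using (hasPsiTwoBound_iff_lintegral hX).1 h

lemma HasPsiTwoBound.mono {X : Ω → ℝ} {S T : ℝ} (hS : 0 < S) (hST : S ≤ T)
    (hX : AEMeasurable X μ) (h : HasPsiTwoBound X S μ) : HasPsiTwoBound X T μ := by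
  rw [hasPsiTwoBound_iff_lintegral hX] at h ⊢
  refine le_trans (lintegral_mono fun ω => ?_) h
  gcongr

/-- Asking for `T` strictly above the norm avoids showing that the infimum is attained. The entries
are therefore used later at scale `2K`. -/
lemma hasPsiTwoBound_of_orliczNorm_lt {X : Ω → ℝ} {T : ℝ} (hX : AEMeasurable X μ)
    (h : orliczNorm 2 X μ < ENNReal.ofReal T) : HasPsiTwoBound X T μ := by
  obtain ⟨s, ⟨t, ht, rfl, hle⟩, hlt⟩ := sInf_lt_iff.1 h
  simp only [abs_rpow_two_div] at hle
  have : t < T := (ENNReal.ofReal_lt_ofReal_iff_of_nonneg ht.le).1 hlt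
  exact ((hasPsiTwoBound_iff_lintegral hX).2 hle).mono ht this.le hX

lemma hasPsiTwoBound_of_identDistrib {X Y : Ω → ℝ} {T : ℝ} (h : IdentDistrib X Y μ μ)
    (hX : HasPsiTwoBound X T μ) : HasPsiTwoBound Y T μ := by
  rw [hasPsiTwoBound_iff_lintegral h.aemeasurable_fst] at hX
  rw [hasPsiTwoBound_iff_lintegral h.aemeasurable_snd]
  have hm : Measurable fun x : ℝ => ENNReal.ofReal (Real.exp (x ^ 2 / T ^ 2)) := by fun_prop
  exact (h.comp hm).lintegral_eq ▸ hX

/-- Convexity of `exp` between `0` and `x`. Integrated, it lowers an exponential moment to any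
prescribed bound above 1 by shrinking the exponent. -/
lemma exp_mul_le_convex {θ : ℝ} (h0 : 0 ≤ θ) (h1 : θ ≤ 1) (x : ℝ) :
    Real.exp (θ * x) ≤ (1 - θ) + θ * Real.exp x := by
  have := convexOn_exp.2 (Set.mem_univ 0) (Set.mem_univ x) (sub_nonneg.2 h1) h0 (by ring)
  simpa using this

lemma integrable_exp_mul_of_integrable [IsFiniteMeasure μ] {f : Ω → ℝ} (hf : AEMeasurable f μ)
    {θ : ℝ} (h0 : 0 ≤ θ) (h1 : θ ≤ 1) (h : Integrable (fun ω => Real.exp (f ω)) μ) :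
    Integrable (fun ω => Real.exp (θ * f ω)) μ := by
  refine Integrable.mono' ((integrable_const (1 - θ)).add (h.const_mul θ))
    (Real.measurable_exp.comp_aemeasurable (hf.const_mul θ)).aestronglyMeasurable
    (Filter.Eventually.of_forall fun ω => ?_)
  rw [Real.norm_of_nonneg (Real.exp_pos _).le]
  exact exp_mul_le_convex h0 h1 _

lemma integral_exp_mul_le [IsProbabilityMeasure μ] {f : Ω → ℝ} (hf : AEMeasurable f μ)
    {θ : ℝ} (h0 : 0 ≤ θ) (h1 : θ ≤ 1) (h : Integrable (fun ω => Real.exp (f ω)) μ) :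
    ∫ ω, Real.exp (θ * f ω) ∂μ ≤ (1 - θ) + θ * ∫ ω, Real.exp (f ω) ∂μ := by
  have := integral_mono (integrable_exp_mul_of_integrable hf h0 h1 h)
    ((integrable_const (1 - θ)).add (h.const_mul θ)) fun ω => exp_mul_le_convex h0 h1 (f ω)
  refine this.trans_eq ?_
  simp only [Pi.add_apply]
  rw [integral_add (integrable_const _) (h.const_mul θ), integral_const_mul]
  simp

/-- Layer-cake formula: `𝔼 exp (f/2) - 1` is the integral of `exp (t/2) / 2` against the tail of
`f`, hence at most `∫ (M/2) exp (-t/2) dt = M`. -/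
lemma lintegral_exp_half_le_of_tail [IsProbabilityMeasure μ] {f : Ω → ℝ} {M : ℝ} (hM : 0 ≤ M)
    (hf : Measurable f) (hf0 : ∀ ω, 0 ≤ f ω)
    (htail : ∀ v > 0, μ.real {ω | v ≤ f ω} ≤ M * Real.exp (-v)) :
    ∫⁻ ω, ENNReal.ofReal (Real.exp (f ω / 2)) ∂μ ≤ ENNReal.ofReal (1 + M) := by
  have hint : ∀ x : ℝ, ∫ t in (0 : ℝ)..x, (1 / 2) * Real.exp (t / 2) = Real.exp (x / 2) - 1 := by
    intro x
    have h : ∀ t ∈ Set.uIcc 0 x, HasDerivAt (fun t => Real.exp (t / 2))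
        ((1 / 2) * Real.exp (t / 2)) t := by
      intro t _
      have := ((hasDerivAt_id t).div_const 2).exp
      simpa [mul_comm] using this
    rw [intervalIntegral.integral_eq_sub_of_hasDerivAt h
      ((by fun_prop : Continuous fun t : ℝ => (1 / 2) * Real.exp (t / 2)).intervalIntegrable _ _)]
    simp
  have hlc := lintegral_comp_eq_lintegral_meas_le_mul μ (f := f)
    (g := fun t => (1 / 2) * Real.exp (t / 2)) (Filter.Eventually.of_forall hf0) hf.aemeasurable
    (fun t _ => (by fun_prop : Continuous fun t : ℝ =>
      (1 / 2) * Real.exp (t / 2)).intervalIntegrable _ _)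
    (Filter.Eventually.of_forall fun t => by positivity)
  simp only [hint] at hlc
  have hrhs : ∫⁻ t in Set.Ioi (0 : ℝ), μ {a | t ≤ f a} * ENNReal.ofReal (1 / 2 * Real.exp (t / 2))
      ≤ ENNReal.ofReal M := by
    have hle : ∫⁻ t in Set.Ioi (0 : ℝ), μ {a | t ≤ f a} *
        ENNReal.ofReal (1 / 2 * Real.exp (t / 2)) ≤
        ∫⁻ t in Set.Ioi (0 : ℝ), ENNReal.ofReal ((M / 2) * Real.exp ((-1 / 2) * t)) := by
      refine setLIntegral_mono (by fun_prop) fun t ht => ?_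
      have h1 : μ {a | t ≤ f a} ≤ ENNReal.ofReal (M * Real.exp (-t)) := by
        rw [← ofReal_measureReal]
        exact ENNReal.ofReal_le_ofReal (htail t ht)
      refine (mul_le_mul_left h1 _).trans ?_
      rw [← ENNReal.ofReal_mul (by positivity)]
      refine ENNReal.ofReal_le_ofReal (le_of_eq ?_)
      rw [show (-1 / 2) * t = -t + t / 2 by ring, Real.exp_add]
      ring
    refine hle.trans ?_
    have hI : IntegrableOn (fun t : ℝ => (M / 2) * Real.exp ((-1 / 2) * t)) (Set.Ioi 0) :=
      (integrableOn_exp_mul_Ioi (by norm_num) 0).const_mul _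
    rw [← ofReal_integral_eq_lintegral_ofReal hI (Filter.Eventually.of_forall fun t => by positivity)]
    refine ENNReal.ofReal_le_ofReal (le_of_eq ?_)
    rw [integral_const_mul, integral_exp_mul_Ioi (by norm_num)]
    simp
  have hsplit : ∀ ω, ENNReal.ofReal (Real.exp (f ω / 2)) =
      1 + ENNReal.ofReal (Real.exp (f ω / 2) - 1) := by
    intro ω
    rw [← ENNReal.ofReal_one, ← ENNReal.ofReal_add zero_le_one]
    · ring_nf
    · have := Real.one_le_exp (show 0 ≤ f ω / 2 by have := hf0 ω; positivity)
      linarith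
  simp_rw [hsplit]
  rw [lintegral_add_left measurable_const, hlc, ENNReal.ofReal_add zero_le_one hM]
  simp only [lintegral_const, measure_univ, mul_one, ENNReal.ofReal_one]
  gcongr

/-- A Gaussian tail bound gives a bound for the `ψ₂` norm. -/
lemma hasPsiTwoBound_of_tail [IsProbabilityMeasure μ] {X : Ω → ℝ} {M D : ℝ} (hM : 1 ≤ M)
    (hD : 0 < D) (hX : Measurable X)
    (htail : ∀ t > 0, μ.real {ω | t * D ≤ |X ω|} ≤ M * Real.exp (-t ^ 2)) :
    HasPsiTwoBound X (Real.sqrt (2 * M) * D) μ := by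
  have hf : Measurable fun ω => X ω ^ 2 / D ^ 2 := by fun_prop
  have hl := lintegral_exp_half_le_of_tail (μ := μ) (f := fun ω => X ω ^ 2 / D ^ 2) (M := M)
    (by linarith) hf (fun ω => by positivity) (by
      intro v hv
      have h := htail (Real.sqrt v) (Real.sqrt_pos.2 hv)
      rw [Real.sq_sqrt hv.le] at h
      have hset : {ω | v ≤ X ω ^ 2 / D ^ 2} = {ω | Real.sqrt v * D ≤ |X ω|} := by
        ext ω
        simp only [Set.mem_ofPred_eq]
        rw [le_div_iff₀ (by positivity), ← Real.sqrt_le_sqrt_iff (by positivity),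
          Real.sqrt_sq_eq_abs, Real.sqrt_mul hv.le, Real.sqrt_sq hD.le]
      rwa [hset])
  have h0 : ∀ ω, 0 ≤ Real.exp (X ω ^ 2 / D ^ 2 / 2) := fun ω => (Real.exp_pos _).le
  have hm : AEStronglyMeasurable (fun ω => Real.exp (X ω ^ 2 / D ^ 2 / 2)) μ := by
    have : Measurable fun ω => Real.exp (X ω ^ 2 / D ^ 2 / 2) := by fun_prop
    exact this.aestronglyMeasurable
  have hi : Integrable (fun ω => Real.exp (X ω ^ 2 / D ^ 2 / 2)) μ :=
    ⟨hm, by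
      rw [hasFiniteIntegral_iff_ofReal (Filter.Eventually.of_forall h0)]
      exact hl.trans_lt (by simp)⟩
  have hb : ∫ ω, Real.exp (X ω ^ 2 / D ^ 2 / 2) ∂μ ≤ 1 + M := by
    rw [integral_eq_lintegral_of_nonneg_ae (Filter.Eventually.of_forall h0) hm]
    exact ENNReal.toReal_le_of_le_ofReal (by linarith) hl
  -- The exponent is shrunk by `θ = 1/M`, for which `(1 - θ) + θ (1 + M) = 2`.
  have hθ0 : 0 ≤ 1 / M := by positivity
  have hθ1 : 1 / M ≤ 1 := by rw [div_le_one (by linarith)]; exact hM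
  have heq : ∀ ω, X ω ^ 2 / (Real.sqrt (2 * M) * D) ^ 2 = 1 / M * (X ω ^ 2 / D ^ 2 / 2) := by
    intro ω
    rw [mul_pow, Real.sq_sqrt (by linarith)]
    field_simp
  refine ⟨?_, ?_⟩
  · simp_rw [heq]
    exact integrable_exp_mul_of_integrable (by fun_prop) hθ0 hθ1 hi
  · simp_rw [heq]
    refine (integral_exp_mul_le (by fun_prop) hθ0 hθ1 hi).trans ?_
    have : 1 / M * ∫ ω, Real.exp (X ω ^ 2 / D ^ 2 / 2) ∂μ ≤ 1 / M * (1 + M) := by gcongr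
    have h2 : 1 / M * (1 + M) = 1 / M + 1 := by field_simp
    linarith

lemma HasPsiTwoBound.integrable_sq [IsFiniteMeasure μ] {X : Ω → ℝ} {T : ℝ} (hT : 0 < T)
    (hX : AEMeasurable X μ) (h : HasPsiTwoBound X T μ) : Integrable (fun ω => X ω ^ 2) μ := by
  refine Integrable.mono' (h.integrable.const_mul (T ^ 2)) (hX.pow_const 2).aestronglyMeasurable
    (Filter.Eventually.of_forall fun ω => ?_)
  rw [Real.norm_of_nonneg (sq_nonneg _)]
  have := Real.add_one_le_exp (X ω ^ 2 / T ^ 2)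
  calc X ω ^ 2 = T ^ 2 * (X ω ^ 2 / T ^ 2) := by field_simp
    _ ≤ _ := by gcongr; linarith

lemma HasPsiTwoBound.integral_sq_le [IsProbabilityMeasure μ] {X : Ω → ℝ} {T : ℝ} (hT : 0 < T)
    (hX : AEMeasurable X μ) (h : HasPsiTwoBound X T μ) : ∫ ω, X ω ^ 2 ∂μ ≤ T ^ 2 := by
  have h1 : ∫ ω, (X ω ^ 2 / T ^ 2 + 1) ∂μ ≤ ∫ ω, Real.exp (X ω ^ 2 / T ^ 2) ∂μ :=
    integral_mono (((h.integrable_sq hT hX).div_const _).add (integrable_const _)) h.integrable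
      fun ω => Real.add_one_le_exp _
  rw [integral_add ((h.integrable_sq hT hX).div_const _) (integrable_const _),
    integral_div] at h1
  simp only [integral_const, probReal_univ, one_smul] at h1
  have h2 : (∫ ω, X ω ^ 2 ∂μ) / T ^ 2 ≤ 1 := by linarith [h.integral_le]
  rwa [div_le_one (by positivity)] at h2

lemma HasPsiTwoBound.memLp_two [IsFiniteMeasure μ] {X : Ω → ℝ} {T : ℝ} (hT : 0 < T)
    (hX : AEMeasurable X μ) (h : HasPsiTwoBound X T μ) : MemLp X 2 μ :=
  (memLp_two_iff_integrable_sq hX.aestronglyMeasurable).2 (h.integrable_sq hT hX)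

/-- Centering costs at most a constant factor in the `ψ₂` norm. -/
lemma HasPsiTwoBound.sub_integral [IsProbabilityMeasure μ] {X : Ω → ℝ} {T : ℝ} (hT : 0 < T)
    (hX : AEMeasurable X μ) (h : HasPsiTwoBound X T μ) :
    HasPsiTwoBound (fun ω => X ω - ∫ ω', X ω' ∂μ) (3 * T) μ := by
  set e := ∫ ω', X ω' ∂μ with he
  have hL2 := h.memLp_two hT hX
  have he2 : e ^ 2 ≤ T ^ 2 := by
    have h1 := variance_nonneg X μ
    rw [variance_eq_sub hL2] at h1
    have h2 := h.integral_sq_le hT hX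
    simp only [Pi.pow_apply] at h1
    linarith
  -- Here `(X - e)² ≤ 2X² + 2T²` and `2/9 ≤ 1/4`. The resulting expectation is at most `exp (1/4) ·
  -- 5/4 ≤ (4/3)(5/4) < 2`.
  have hpt : ∀ ω, Real.exp ((X ω - e) ^ 2 / (3 * T) ^ 2) ≤
      Real.exp (1 / 4) * Real.exp ((1 / 4) * (X ω ^ 2 / T ^ 2)) := by
    intro ω
    rw [← Real.exp_add]
    refine Real.exp_le_exp.2 ?_
    have h3 : (1 / 4 : ℝ) + 1 / 4 * (X ω ^ 2 / T ^ 2) = (T ^ 2 + X ω ^ 2) / 4 / T ^ 2 := by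
      field_simp
    rw [h3, mul_pow, ← div_div]
    refine div_le_div_of_nonneg_right ?_ (sq_nonneg T)
    nlinarith [sq_nonneg (X ω + e), sq_nonneg (X ω), sq_nonneg T]
  have hf : AEMeasurable (fun ω => X ω ^ 2 / T ^ 2) μ := (hX.pow_const 2).div_const _
  have hi := integrable_exp_mul_of_integrable hf (θ := 1 / 4) (by norm_num) (by norm_num)
    h.integrable
  have hI := integral_exp_mul_le hf (θ := 1 / 4) (by norm_num) (by norm_num) h.integrable
  have hii : Integrable (fun ω => Real.exp ((X ω - e) ^ 2 / (3 * T) ^ 2)) μ := by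
    refine Integrable.mono' (hi.const_mul (Real.exp (1 / 4)))
      (Real.measurable_exp.comp_aemeasurable
        (((hX.sub_const e).pow_const 2).div_const _)).aestronglyMeasurable
      (Filter.Eventually.of_forall fun ω => ?_)
    rw [Real.norm_of_nonneg (Real.exp_pos _).le]
    exact hpt ω
  refine ⟨hii, ?_⟩
  refine (integral_mono hii (hi.const_mul (Real.exp (1 / 4))) hpt).trans ?_
  rw [integral_const_mul]
  have h4 : Real.exp (1 / 4 : ℝ) ≤ 4 / 3 := by
    have := Real.add_one_le_exp (-(1 / 4) : ℝ)
    rw [Real.exp_neg] at this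
    have hp := Real.exp_pos (1 / 4 : ℝ)
    rw [le_inv_comm₀ (by norm_num) hp] at this
    norm_num at this ⊢
    exact this
  have h5 := h.integral_le
  have h6 : 0 ≤ ∫ ω, Real.exp (1 / 4 * (X ω ^ 2 / T ^ 2)) ∂μ :=
    integral_nonneg fun ω => (Real.exp_pos _).le
  nlinarith

/-! ### Elementary inequalities for powers and exponentials -/

/-- Raise `y ≤ b exp (y/b)` to the power `a/2`, with `y = w²` and `b = a/(2c)`. With `a = 2p` and `c
= 1/2` this yields the constant `B`, depending only on `p`, that controls all moments below. -/
lemma exists_rpow_le_mul_exp_sq {a c : ℝ} (ha : 0 < a) (hc : 0 < c) :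
    ∃ B : ℝ, 0 < B ∧ ∀ w : ℝ, 0 ≤ w → w ^ a ≤ B * Real.exp (c * w ^ 2) := by
  have hb : 0 < a / 2 / c := by positivity
  refine ⟨(a / 2 / c) ^ (a / 2), by positivity, fun w hw => ?_⟩
  have h1 : w ^ 2 ≤ (a / 2 / c) * Real.exp (w ^ 2 / (a / 2 / c)) := by
    have := Real.add_one_le_exp (w ^ 2 / (a / 2 / c))
    calc w ^ 2 = (a / 2 / c) * (w ^ 2 / (a / 2 / c)) := by field_simp
      _ ≤ _ := by gcongr; linarith
  calc w ^ a = (w ^ 2) ^ (a / 2) := by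
        rw [← Real.rpow_natCast w 2, ← Real.rpow_mul hw]; congr 1; push_cast; ring
    _ ≤ ((a / 2 / c) * Real.exp (w ^ 2 / (a / 2 / c))) ^ (a / 2) := by gcongr
    _ = _ := by
        rw [Real.mul_rpow hb.le (Real.exp_pos _).le, ← Real.exp_mul]
        congr 2
        field_simp

lemma rpow_eq_rpow_sub_one_mul {x p : ℝ} (hx : 0 ≤ x) (hp : 1 ≤ p) :
    x ^ p = x ^ (p - 1) * x := by
  rw [← Real.rpow_add_one' hx (by linarith)]
  congr 1; ring

/-- Since `a^p = a^(p-1) a ≥ b^(p-1) (b + τ)`, the power grows with slope at least `b^(p-1)` above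
`b`. The next lemma gives the same slope below the centre; together they turn deviations of the norm
into deviations of the sum of powers. -/
lemma rpow_add_mul_le_of_add_le {a b τ p : ℝ} (hb : 0 ≤ b) (hτ : 0 ≤ τ) (hp : 1 ≤ p)
    (h : b + τ ≤ a) : b ^ p + b ^ (p - 1) * τ ≤ a ^ p := by
  have ha : 0 ≤ a := by linarith
  rw [rpow_eq_rpow_sub_one_mul hb hp, rpow_eq_rpow_sub_one_mul ha hp, ← mul_add]
  have : b ^ (p - 1) ≤ a ^ (p - 1) := Real.rpow_le_rpow hb (by linarith) (by linarith)
  gcongr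

lemma rpow_add_mul_le_of_add_le' {a b τ p : ℝ} (ha : 0 ≤ a) (hτ : 0 ≤ τ) (hp : 1 ≤ p)
    (h : a + τ ≤ b) : a ^ p + b ^ (p - 1) * τ ≤ b ^ p := by
  have hb : 0 ≤ b := by linarith
  rw [rpow_eq_rpow_sub_one_mul hb hp, rpow_eq_rpow_sub_one_mul ha hp]
  have : a ^ (p - 1) ≤ b ^ (p - 1) := Real.rpow_le_rpow ha (by linarith) (by linarith)
  have h1 : a ^ (p - 1) * a ≤ b ^ (p - 1) * a := by gcongr
  have h2 : b ^ (p - 1) * a + b ^ (p - 1) * τ ≤ b ^ (p - 1) * b := by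
    rw [← mul_add]; gcongr
  linarith

lemma rpow_add_rpow_le_of_add_le {a b τ p : ℝ} (hb : 0 ≤ b) (hτ : 0 ≤ τ) (hp : 1 ≤ p)
    (h : b + τ ≤ a) : b ^ p + τ ^ p ≤ a ^ p := by
  refine (Real.add_rpow_le_rpow_add hb hτ hp).trans ?_
  gcongr

/-- The inequality `exp x ≤ 1 + x exp x`, which is `exp (-x) ≥ 1 - x`, is inserted into itself. -/
lemma exp_le_one_add_add_sq_mul_exp {x : ℝ} (hx : 0 ≤ x) :
    Real.exp x ≤ 1 + x + x ^ 2 * Real.exp x := by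
  have h : Real.exp x ≤ 1 + x * Real.exp x := by
    have h1 := Real.add_one_le_exp (-x)
    have h2 : (-x + 1) * Real.exp x ≤ Real.exp (-x) * Real.exp x := by gcongr
    rw [← Real.exp_add, neg_add_cancel, Real.exp_zero] at h2
    linarith
  have h3 : x * Real.exp x ≤ x * (1 + x * Real.exp x) := by gcongr
  linarith

/-- Follows from `exp x ≥ 1 + x` and `(1 + x)(1 - x + x²) = 1 + x³ ≥ 1`. -/
lemma exp_neg_le_one_sub_add_sq {x : ℝ} (hx : 0 ≤ x) : Real.exp (-x) ≤ 1 - x + x ^ 2 := by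
  have h1 := Real.add_one_le_exp x
  rw [Real.exp_neg, inv_le_comm₀ (Real.exp_pos _) (by nlinarith [sq_nonneg (x - 1 / 2)])]
  refine le_trans ?_ h1
  rw [inv_le_comm₀ (by nlinarith [sq_nonneg (x - 1 / 2)]) (by linarith),
    inv_le_iff_one_le_mul₀ (by linarith)]
  nlinarith [pow_nonneg hx 3]

/-! ### Chernoff bounds for sums over a normalized family -/

lemma integral_one_add_mul_add_mul [IsProbabilityMeasure μ] {f g : Ω → ℝ} (hf : Integrable f μ)
    (hg : Integrable g μ) (a b : ℝ) :
    ∫ ω, (1 + a * f ω + b * g ω) ∂μ = 1 + a * ∫ ω, f ω ∂μ + b * ∫ ω, g ω ∂μ := by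
  have h1 : Integrable (fun ω => 1 + a * f ω) μ := (integrable_const 1).add (hf.const_mul a)
  rw [integral_add h1 (hg.const_mul b), integral_add (integrable_const 1) (hf.const_mul a),
    integral_const_mul, integral_const_mul]
  simp

/-- Chernoff's bound for a sum of independent variables. -/
lemma measure_sum_ge_le_exp {ι : Type*} [Fintype ι] {V : ι → Ω → ℝ} (hind : iIndepFun V μ)
    (hV : ∀ i, Measurable (V i)) {l κ : ℝ} (hl : 0 ≤ l)
    (hint : ∀ i, Integrable (fun ω => Real.exp (l * V i ω)) μ)
    (hmgf : ∀ i, ∫ ω, Real.exp (l * V i ω) ∂μ ≤ Real.exp κ) (u : ℝ) :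
    μ.real {ω | u ≤ ∑ i, V i ω} ≤ Real.exp (-(l * u) + Fintype.card ι * κ) := by
  have : IsProbabilityMeasure μ := hind.isProbabilityMeasure
  have hi := hind.integrable_exp_mul_sum hV (s := Finset.univ) (t := l) fun i _ => hint i
  have h1 := measure_ge_le_exp_mul_mgf (μ := μ) u hl hi
  simp only [Finset.sum_apply] at h1
  refine h1.trans ?_
  rw [hind.mgf_sum hV, Real.exp_add, Real.exp_nat_mul, neg_mul]
  gcongr
  refine (Finset.prod_le_prod (fun i _ => mgf_nonneg) fun i _ => hmgf i).trans_eq ?_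
  simp

/-- Independent nonnegative variables `W i` with `𝔼 exp (W i ^ 2) ≤ 2` and `𝔼 (W i) ^ p = s ^ p`. -/
structure IsNormalizedFamily {m : ℕ} (W : Fin m → Ω → ℝ) (p s : ℝ) (μ : Measure Ω) : Prop where
  measurable : ∀ i, Measurable (W i)
  nonneg : ∀ i ω, 0 ≤ W i ω
  indep : iIndepFun W μ
  integrable_exp : ∀ i, Integrable (fun ω => Real.exp (W i ω ^ 2)) μ
  integral_exp_le : ∀ i, ∫ ω, Real.exp (W i ω ^ 2) ∂μ ≤ 2
  integral_rpow : ∀ i, ∫ ω, W i ω ^ p ∂μ = s ^ p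

namespace IsNormalizedFamily

variable {m : ℕ} {W : Fin m → Ω → ℝ} {p s B : ℝ}

lemma integrable_of_le (h : IsNormalizedFamily W p s μ) (i : Fin m) {g : ℝ → ℝ}
    (hg : Measurable g) {A : ℝ} (hle : ∀ w, 0 ≤ w → |g w| ≤ A * Real.exp (w ^ 2)) :
    Integrable (fun ω => g (W i ω)) μ :=
  Integrable.mono' ((h.integrable_exp i).const_mul A)
    (hg.comp (h.measurable i)).aestronglyMeasurable
    (Filter.Eventually.of_forall fun ω => hle _ (h.nonneg i ω))

lemma integral_le_of_le (h : IsNormalizedFamily W p s μ) (i : Fin m) {g : ℝ → ℝ}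
    (hg : Measurable g) {A : ℝ} (hA : 0 ≤ A) (hle : ∀ w, 0 ≤ w → |g w| ≤ A * Real.exp (w ^ 2)) :
    ∫ ω, g (W i ω) ∂μ ≤ 2 * A := by
  have h1 := integral_mono (h.integrable_of_le i hg hle) ((h.integrable_exp i).const_mul A)
    fun ω => (le_abs_self _).trans (hle _ (h.nonneg i ω))
  rw [integral_const_mul] at h1
  nlinarith [h.integral_exp_le i]

lemma rpow_le_mul_exp (hp : 1 ≤ p) (hB : ∀ w : ℝ, 0 ≤ w → w ^ (2 * p) ≤ B * Real.exp (w ^ 2 / 2))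
    {w : ℝ} (hw : 0 ≤ w) : w ^ p ≤ (1 + B) * Real.exp (w ^ 2) := by
  have h1 : w ^ p ≤ 1 + w ^ (2 * p) := by
    have : w ^ (2 * p) = (w ^ p) ^ 2 := by
      rw [mul_comm, Real.rpow_mul hw, Real.rpow_two]
    rw [this]
    nlinarith [sq_nonneg (w ^ p - 1 / 2)]
  have h2 := hB w hw
  have h3 : Real.exp (w ^ 2 / 2) ≤ Real.exp (w ^ 2) :=
    Real.exp_le_exp.2 (by nlinarith [sq_nonneg w])
  have h4 : 1 ≤ Real.exp (w ^ 2) := Real.one_le_exp (sq_nonneg w)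
  have hB0 : 0 ≤ B := by
    have h5 := hB 0 le_rfl
    rw [Real.zero_rpow (by linarith)] at h5
    simpa using h5
  nlinarith [mul_le_mul_of_nonneg_left h3 hB0]

lemma integrable_rpow (h : IsNormalizedFamily W p s μ) (hp : 1 ≤ p)
    (hB : ∀ w : ℝ, 0 ≤ w → w ^ (2 * p) ≤ B * Real.exp (w ^ 2 / 2)) (i : Fin m) :
    Integrable (fun ω => W i ω ^ p) μ := by
  refine h.integrable_of_le (g := fun w => w ^ p) i (by fun_prop) (A := 1 + B) fun w hw => ?_
  rw [abs_of_nonneg (by positivity)]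
  exact rpow_le_mul_exp hp hB hw

/-- The condition on `l * g` keeps `exp (l g) ≤ 2 exp (w²/2)`, while `g² ≤ B exp (w²/2)`; so `𝔼 g²
exp (l g) ≤ 4B` and the second-order expansion bounds the moment generating function. The function
`g` stays general so as to cover both `w^p` for `p ≤ 2` and its truncation for `p ≥ 2`. -/
lemma measure_sum_ge_le (h : IsNormalizedFamily W p s μ) (hp : 1 ≤ p)
    (hB0 : 0 < B) (hB : ∀ w : ℝ, 0 ≤ w → w ^ (2 * p) ≤ B * Real.exp (w ^ 2 / 2))
    {g : ℝ → ℝ} (hg : Measurable g) (hg0 : ∀ w, 0 ≤ w → 0 ≤ g w)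
    (hgp : ∀ w, 0 ≤ w → g w ≤ w ^ p) {l : ℝ} (hl : 0 ≤ l)
    (hlg : ∀ w, 0 ≤ w → l * g w ≤ (1 + w ^ 2) / 4) (u : ℝ) :
    μ.real {ω | m * s ^ p + u ≤ ∑ i, g (W i ω)} ≤ Real.exp (-(l * u) + l ^ 2 * (4 * B) * m) := by
  have hprob : IsProbabilityMeasure μ := h.indep.isProbabilityMeasure
  have hexp : ∀ w, 0 ≤ w → Real.exp (l * g w) ≤ 2 * Real.exp (w ^ 2 / 2) := by
    intro w hw
    have h1 : Real.exp (l * g w) ≤ Real.exp (1 / 4) * Real.exp (w ^ 2 / 4) := by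
      rw [← Real.exp_add]
      exact Real.exp_le_exp.2 (by linarith [hlg w hw])
    have h2 : Real.exp (1 / 4 : ℝ) ≤ 2 := by
      have := Real.exp_bound_div_one_sub_of_interval (x := 1 / 4) (by norm_num) (by norm_num)
      norm_num at this ⊢
      linarith
    have h3 : Real.exp (w ^ 2 / 4) ≤ Real.exp (w ^ 2 / 2) :=
      Real.exp_le_exp.2 (by nlinarith [sq_nonneg w])
    refine h1.trans ?_
    gcongr
  have hexp' : ∀ w, 0 ≤ w → |Real.exp (l * g w)| ≤ 2 * Real.exp (w ^ 2) := by
    intro w hw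
    rw [abs_of_pos (Real.exp_pos _)]
    refine (hexp w hw).trans ?_
    have : Real.exp (w ^ 2 / 2) ≤ Real.exp (w ^ 2) :=
      Real.exp_le_exp.2 (by nlinarith [sq_nonneg w])
    gcongr
  have hgabs : ∀ w, 0 ≤ w → |g w| ≤ (1 + B) * Real.exp (w ^ 2) := fun w hw => by
    rw [abs_of_nonneg (hg0 w hw)]
    exact (hgp w hw).trans (rpow_le_mul_exp hp hB hw)
  have hquad : ∀ w, 0 ≤ w → |g w ^ 2 * Real.exp (l * g w)| ≤ (2 * B) * Real.exp (w ^ 2) := by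
    intro w hw
    rw [abs_of_nonneg (by positivity)]
    have h1 : g w ^ 2 ≤ B * Real.exp (w ^ 2 / 2) := by
      refine le_trans ?_ (hB w hw)
      rw [mul_comm 2 p, Real.rpow_mul hw, Real.rpow_two]
      exact pow_le_pow_left₀ (hg0 w hw) (hgp w hw) 2
    calc g w ^ 2 * Real.exp (l * g w)
        ≤ (B * Real.exp (w ^ 2 / 2)) * (2 * Real.exp (w ^ 2 / 2)) := by
          gcongr
          exact hexp w hw
      _ = (2 * B) * (Real.exp (w ^ 2 / 2) * Real.exp (w ^ 2 / 2)) := by ring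
      _ = _ := by rw [← Real.exp_add, add_halves]
  have hIe : ∀ i, Integrable (fun ω => Real.exp (l * g (W i ω))) μ := fun i =>
    h.integrable_of_le (g := fun w => Real.exp (l * g w)) i (by fun_prop) hexp'
  have hIq : ∀ i, Integrable (fun ω => g (W i ω) ^ 2 * Real.exp (l * g (W i ω))) μ := fun i =>
    h.integrable_of_le (g := fun w => g w ^ 2 * Real.exp (l * g w)) i (by fun_prop) hquad
  have hIg : ∀ i, Integrable (fun ω => g (W i ω)) μ := fun i => h.integrable_of_le i hg hgabs
  have hmgf : ∀ i, ∫ ω, Real.exp (l * g (W i ω)) ∂μ ≤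
      Real.exp (l * s ^ p + l ^ 2 * (4 * B)) := by
    intro i
    have hmono : ∫ ω, Real.exp (l * g (W i ω)) ∂μ ≤
        ∫ ω, (1 + l * g (W i ω) + l ^ 2 * (g (W i ω) ^ 2 * Real.exp (l * g (W i ω)))) ∂μ := by
      refine integral_mono (hIe i)
        (((integrable_const 1).add ((hIg i).const_mul l)).add ((hIq i).const_mul _)) fun ω => ?_
      have := exp_le_one_add_add_sq_mul_exp (mul_nonneg hl (hg0 _ (h.nonneg i ω)))
      refine this.trans_eq ?_
      ring
    rw [integral_one_add_mul_add_mul (hIg i) (hIq i)] at hmono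
    have h1 : ∫ ω, g (W i ω) ∂μ ≤ s ^ p := by
      rw [← h.integral_rpow i]
      exact integral_mono (hIg i) (h.integrable_rpow hp hB i) fun ω => hgp _ (h.nonneg i ω)
    have h2 : ∫ ω, g (W i ω) ^ 2 * Real.exp (l * g (W i ω)) ∂μ ≤ 2 * (2 * B) :=
      h.integral_le_of_le (g := fun w => g w ^ 2 * Real.exp (l * g w)) i (by fun_prop)
        (by positivity) hquad
    have h3 := Real.add_one_le_exp (l * s ^ p + l ^ 2 * (4 * B))
    have h4 := mul_le_mul_of_nonneg_left h1 hl
    have h5 := mul_le_mul_of_nonneg_left h2 (sq_nonneg l)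
    linarith
  have hfin := measure_sum_ge_le_exp (V := fun i ω => g (W i ω))
    (h.indep.comp (fun _ => g) fun _ => hg) (fun i => hg.comp (h.measurable i)) hl hIe hmgf
    (m * s ^ p + u)
  refine hfin.trans_eq ?_
  rw [Fintype.card_fin]
  congr 1
  ring

/-- For nonnegative variables `exp (-x) ≤ 1 - x + x²` needs only a second moment, so every `l ≥ 0`
is allowed and the lower tail requires neither truncation nor a case distinction on `p`. -/
lemma measure_sum_rpow_le_le (h : IsNormalizedFamily W p s μ) (hp : 1 ≤ p)
    (hB0 : 0 < B) (hB : ∀ w : ℝ, 0 ≤ w → w ^ (2 * p) ≤ B * Real.exp (w ^ 2 / 2))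
    {l : ℝ} (hl : 0 ≤ l) (u : ℝ) :
    μ.real {ω | ∑ i, W i ω ^ p + u ≤ m * s ^ p} ≤ Real.exp (-(l * u) + l ^ 2 * (2 * B) * m) := by
  have hprob : IsProbabilityMeasure μ := h.indep.isProbabilityMeasure
  have hg : Measurable fun w : ℝ => -w ^ p := by fun_prop
  have hIe : ∀ i, Integrable (fun ω => Real.exp (l * (-(W i ω) ^ p))) μ := fun i => by
    refine h.integrable_of_le (g := fun w => Real.exp (l * (-w ^ p))) i (by fun_prop) (A := 1)
      fun w hw => ?_
    rw [abs_of_pos (Real.exp_pos _), one_mul]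
    refine Real.exp_le_exp.2 ?_
    have : 0 ≤ l * w ^ p := by positivity
    nlinarith [sq_nonneg w]
  have hquad : ∀ w, 0 ≤ w → |(w ^ p) ^ 2| ≤ B * Real.exp (w ^ 2) := by
    intro w hw
    rw [abs_of_nonneg (by positivity), ← Real.rpow_two, ← Real.rpow_mul hw, mul_comm p]
    refine (hB w hw).trans ?_
    have : Real.exp (w ^ 2 / 2) ≤ Real.exp (w ^ 2) :=
      Real.exp_le_exp.2 (by nlinarith [sq_nonneg w])
    gcongr
  have hIq : ∀ i, Integrable (fun ω => (W i ω ^ p) ^ 2) μ := fun i =>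
    h.integrable_of_le (g := fun w => (w ^ p) ^ 2) i (by fun_prop) hquad
  have hIg := h.integrable_rpow hp hB
  have hmgf : ∀ i, ∫ ω, Real.exp (l * (-(W i ω) ^ p)) ∂μ ≤
      Real.exp (-(l * s ^ p) + l ^ 2 * (2 * B)) := by
    intro i
    have hmono : ∫ ω, Real.exp (l * (-(W i ω) ^ p)) ∂μ ≤
        ∫ ω, (1 + -l * W i ω ^ p + l ^ 2 * (W i ω ^ p) ^ 2) ∂μ := by
      refine integral_mono (hIe i)
        (((integrable_const 1).add ((hIg i).const_mul (-l))).add ((hIq i).const_mul _)) fun ω => ?_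
      have h0 : 0 ≤ W i ω := h.nonneg i ω
      have := exp_neg_le_one_sub_add_sq (x := l * W i ω ^ p) (by positivity)
      simp only
      rw [mul_neg]
      refine this.trans_eq ?_
      ring
    rw [integral_one_add_mul_add_mul (hIg i) (hIq i), h.integral_rpow i] at hmono
    have h2 : ∫ ω, (W i ω ^ p) ^ 2 ∂μ ≤ 2 * B :=
      h.integral_le_of_le (g := fun w => (w ^ p) ^ 2) i (by fun_prop) hB0.le hquad
    have h3 := Real.add_one_le_exp (-(l * s ^ p) + l ^ 2 * (2 * B))
    have h5 := mul_le_mul_of_nonneg_left h2 (sq_nonneg l)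
    linarith
  have hfin := measure_sum_ge_le_exp (V := fun i ω => -(W i ω) ^ p)
    (h.indep.comp (fun _ w => -w ^ p) fun _ => hg) (fun i => hg.comp (h.measurable i)) hl hIe hmgf
    (-(m * s ^ p) + u)
  have hset : {ω | ∑ i, W i ω ^ p + u ≤ m * s ^ p} =
      {ω | -(m * s ^ p) + u ≤ ∑ i, -(W i ω) ^ p} := by
    ext ω
    simp only [Set.mem_ofPred_eq, Finset.sum_neg_distrib]
    constructor <;> intro h <;> linarith
  rw [hset]
  refine hfin.trans_eq ?_
  rw [Fintype.card_fin]
  congr 1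
  ring

lemma measure_sum_sq_ge_le (h : IsNormalizedFamily W p s μ) (u : ℝ) :
    μ.real {ω | u ≤ ∑ i, W i ω ^ 2} ≤ Real.exp (-u + m) := by
  have hfin := measure_sum_ge_le_exp (V := fun i ω => W i ω ^ 2) (l := 1) (κ := 1)
    (h.indep.comp (fun _ w => w ^ 2) fun _ => by fun_prop)
    (fun i => (h.measurable i).pow_const 2) zero_le_one
    (fun i => by simpa using h.integrable_exp i)
    (fun i => by
      simp only [one_mul]
      have := Real.add_one_le_exp (1 : ℝ)
      linarith [h.integral_exp_le i]) u
  simpa using hfin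

lemma measure_sq_ge_le (h : IsNormalizedFamily W p s μ) (i : Fin m) (u : ℝ) :
    μ.real {ω | u ≤ W i ω ^ 2} ≤ 2 * Real.exp (-u) := by
  have hprob : IsProbabilityMeasure μ := h.indep.isProbabilityMeasure
  have h1 := measure_ge_le_exp_mul_mgf (μ := μ) (X := fun ω => W i ω ^ 2) (t := 1) u zero_le_one
    (by simpa using h.integrable_exp i)
  refine h1.trans ?_
  have : mgf (fun ω => W i ω ^ 2) μ 1 ≤ 2 := by
    simpa [mgf] using h.integral_exp_le i
  rw [neg_one_mul, mul_comm]
  gcongr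

end IsNormalizedFamily

/-! ### Tails of the `ℓ_p` norm of a normalized family -/

lemma sqrt_le_rpow_mul {N p r : ℝ} (hN : 0 < N) (hp : 1 ≤ p) (hr : N ^ (1 / p - 1 / 2) ≤ r) :
    Real.sqrt N ≤ N ^ ((p - 1) / p) * r := by
  calc Real.sqrt N = N ^ ((p - 1) / p) * N ^ (1 / p - 1 / 2) := by
        rw [← Real.rpow_add hN, Real.sqrt_eq_rpow]
        congr 1
        field_simp
        ring
    _ ≤ _ := by gcongr

lemma rpow_one_div_mul_rpow {N s p : ℝ} (hN : 0 ≤ N) (hs : 0 ≤ s) (hp : 1 ≤ p) :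
    (N ^ (1 / p) * s) ^ p = N * s ^ p := by
  rw [Real.mul_rpow (by positivity) hs, ← Real.rpow_mul hN, one_div,
    inv_mul_cancel₀ (by linarith), Real.rpow_one]

lemma rpow_one_div_mul_rpow_sub_one {N s p : ℝ} (hN : 0 ≤ N) (hs : 0 ≤ s) :
    (N ^ (1 / p) * s) ^ (p - 1) = N ^ ((p - 1) / p) * s ^ (p - 1) := by
  rw [Real.mul_rpow (by positivity) hs, ← Real.rpow_mul hN]
  congr 2
  ring

lemma rpow_one_div_rpow_self {x p : ℝ} (hx : 0 ≤ x) (hp : 1 ≤ p) : (x ^ (1 / p)) ^ p = x := by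
  rw [← Real.rpow_mul hx, one_div, inv_mul_cancel₀ (by linarith), Real.rpow_one]

namespace IsNormalizedFamily

variable {m : ℕ} {W : Fin m → Ω → ℝ} {p s B δ r t c : ℝ}

/-- The slope of `y ↦ y ^ p` at the centre `m ^ (1 / p) * s` is at least `δ * √m / r`. -/
lemma mul_sqrt_mul_le (hm : 0 < m) (hp : 1 ≤ p) (hs : 0 ≤ s)
    (hδ : δ ≤ s ^ (p - 1)) (hr : (m : ℝ) ^ (1 / p - 1 / 2) ≤ r) (ht : 0 ≤ t) :
    δ * Real.sqrt m * t ≤ ((m : ℝ) ^ (1 / p) * s) ^ (p - 1) * (t * r) := by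
  have hN : (0 : ℝ) < m := by exact_mod_cast hm
  rw [rpow_one_div_mul_rpow_sub_one hN.le hs]
  have h1 := sqrt_le_rpow_mul hN hp hr
  calc δ * Real.sqrt m * t ≤ s ^ (p - 1) * ((m : ℝ) ^ ((p - 1) / p) * r) * t := by gcongr
    _ = _ := by ring

lemma measure_lower_tail_le (h : IsNormalizedFamily W p s μ) (hm : 0 < m) (hp : 1 ≤ p)
    (hs : 0 ≤ s) (hB0 : 0 < B) (hB : ∀ w : ℝ, 0 ≤ w → w ^ (2 * p) ≤ B * Real.exp (w ^ 2 / 2))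
    (hδ0 : 0 ≤ δ) (hδ : δ ≤ s ^ (p - 1)) (hr0 : 0 ≤ r) (hr : (m : ℝ) ^ (1 / p - 1 / 2) ≤ r)
    (ht : 0 ≤ t) :
    μ.real {ω | (∑ i, W i ω ^ p) ^ (1 / p) + t * r ≤ (m : ℝ) ^ (1 / p) * s} ≤
      Real.exp (-(1 / (8 * B) * (δ * t) ^ 2)) := by
  have hprob : IsProbabilityMeasure μ := h.indep.isProbabilityMeasure
  have hN : (0 : ℝ) < m := by exact_mod_cast hm
  have hsub : {ω | (∑ i, W i ω ^ p) ^ (1 / p) + t * r ≤ (m : ℝ) ^ (1 / p) * s} ⊆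
      {ω | ∑ i, W i ω ^ p + δ * Real.sqrt m * t ≤ m * s ^ p} := by
    intro ω hω
    have hsum : 0 ≤ ∑ i, W i ω ^ p := Finset.sum_nonneg fun i _ => by
      have := h.nonneg i ω; positivity
    have h1 := rpow_add_mul_le_of_add_le' (by positivity) (by positivity) hp hω
    rw [rpow_one_div_mul_rpow hN.le hs hp, rpow_one_div_rpow_self hsum hp] at h1
    have h2 := mul_sqrt_mul_le hm hp hs hδ hr ht
    simp only [Set.mem_ofPred_eq]
    linarith
  refine (measureReal_mono hsub).trans ?_
  -- With `u = δ √m t`, this `l = u/(4Bm)` minimizes `-l u + 2B m l²`; the minimum is `-(δ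
  -- t)²/(8B)`.
  refine (h.measure_sum_rpow_le_le hp hB0 hB (l := δ * Real.sqrt m * t / (4 * B * m))
    (by positivity) _).trans (Real.exp_le_exp.2 (le_of_eq ?_))
  have hsq : Real.sqrt m ^ 2 = m := Real.sq_sqrt hN.le
  have e1 : δ * Real.sqrt m * t / (4 * B * m) * (δ * Real.sqrt m * t) =
      (δ * t) ^ 2 * Real.sqrt m ^ 2 / (4 * B * m) := by ring
  have e2 : (δ * Real.sqrt m * t / (4 * B * m)) ^ 2 * (2 * B) * m =
      (δ * t) ^ 2 * Real.sqrt m ^ 2 * (2 * B) * m / (4 * B * m) ^ 2 := by ring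
  rw [e1, e2, hsq]
  field_simp
  ring

/-- For `t ≤ 2√m` the Chernoff parameter stays below `1/4`, which `w^p ≤ 1 + w²` tolerates. For
larger `t`, Hölder's inequality gives `‖W‖_p ≤ r ‖W‖₂`, and the loss `exp m` in the bound for `∑
W_i²` is absorbed since `m ≤ t²/4`. -/
lemma measure_upper_tail_le_of_le_two (h : IsNormalizedFamily W p s μ) (hm : 0 < m) (hp : 1 ≤ p)
    (hp2 : p ≤ 2) (hs : 0 ≤ s) (hB0 : 0 < B)
    (hB : ∀ w : ℝ, 0 ≤ w → w ^ (2 * p) ≤ B * Real.exp (w ^ 2 / 2))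
    (hc0 : 0 < c) (hc : c ≤ 1 / 8) (hcB : c * (8 * B) ≤ 1)
    (hδ0 : 0 ≤ δ) (hδ1 : δ ≤ 1) (hδ : δ ≤ s ^ (p - 1))
    (hr1 : 1 ≤ r) (hr : (m : ℝ) ^ (1 / p - 1 / 2) ≤ r) (ht : 0 ≤ t) :
    μ.real {ω | (m : ℝ) ^ (1 / p) * s + t * r ≤ (∑ i, W i ω ^ p) ^ (1 / p)} ≤
      Real.exp (-(c / 2 * (δ * t) ^ 2)) := by
  have hprob : IsProbabilityMeasure μ := h.indep.isProbabilityMeasure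
  have hN : (0 : ℝ) < m := by exact_mod_cast hm
  have hsq : Real.sqrt m ^ 2 = m := Real.sq_sqrt hN.le
  have hsq0 : 0 < Real.sqrt m := Real.sqrt_pos.2 hN
  have hWp : ∀ i ω, 0 ≤ W i ω ^ p := fun i ω => by have := h.nonneg i ω; positivity
  rcases le_total t (2 * Real.sqrt m) with htm | htm
  · have hsub : {ω | (m : ℝ) ^ (1 / p) * s + t * r ≤ (∑ i, W i ω ^ p) ^ (1 / p)} ⊆
        {ω | m * s ^ p + δ * Real.sqrt m * t ≤ ∑ i, W i ω ^ p} := by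
      intro ω hω
      have hsum : 0 ≤ ∑ i, W i ω ^ p := Finset.sum_nonneg fun i _ => hWp i ω
      have h1 := rpow_add_mul_le_of_add_le (by positivity) (by positivity) hp hω
      rw [rpow_one_div_mul_rpow hN.le hs hp, rpow_one_div_rpow_self hsum hp] at h1
      have h2 := mul_sqrt_mul_le hm hp hs hδ hr ht
      simp only [Set.mem_ofPred_eq]
      linarith
    refine (measureReal_mono hsub).trans ?_
    have hl : δ * t * c / Real.sqrt m ≤ 1 / 4 := by
      rw [div_le_iff₀ hsq0]
      have : δ * t ≤ 2 * Real.sqrt m := by nlinarith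
      nlinarith [mul_nonneg hδ0 ht]
    have hl0 : 0 ≤ δ * t * c / Real.sqrt m := by positivity
    refine (h.measure_sum_ge_le hp hB0 hB (g := fun w => w ^ p) (by fun_prop)
      (fun w hw => by positivity) (fun w _ => le_rfl) (l := δ * t * c / Real.sqrt m) hl0
      (fun w hw => ?_) _).trans (Real.exp_le_exp.2 ?_)
    · have hw2 : w ^ p ≤ 1 + w ^ 2 := by
        rcases le_total w 1 with hw1 | hw1
        · have := Real.rpow_le_one hw hw1 (by linarith : 0 ≤ p)
          nlinarith [sq_nonneg w]
        · have := Real.rpow_le_rpow_of_exponent_le hw1 hp2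
          rw [Real.rpow_two] at this
          linarith
      calc δ * t * c / Real.sqrt m * w ^ p ≤ (1 / 4) * (1 + w ^ 2) := by gcongr
        _ = _ := by ring
    · have e1 : δ * t * c / Real.sqrt m * (δ * Real.sqrt m * t) = c * (δ * t) ^ 2 := by
        field_simp
      have e2 : (δ * t * c / Real.sqrt m) ^ 2 * (4 * B) * m =
          c * (8 * B) * (c / 2 * (δ * t) ^ 2) := by
        rw [div_pow, hsq]
        field_simp
        ring
      rw [e1, e2]
      have : 0 ≤ c / 2 * (δ * t) ^ 2 := by positivity
      nlinarith
  · have hsub : {ω | (m : ℝ) ^ (1 / p) * s + t * r ≤ (∑ i, W i ω ^ p) ^ (1 / p)} ⊆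
        {ω | t ^ 2 ≤ ∑ i, W i ω ^ 2} := by
      intro ω hω
      simp only [Set.mem_ofPred_eq] at hω ⊢
      have hsum : 0 ≤ ∑ i, W i ω ^ p := Finset.sum_nonneg fun i _ => hWp i ω
      have hbs : 0 ≤ (m : ℝ) ^ (1 / p) * s := by positivity
      have h1 : t * r ≤ (∑ i, W i ω ^ p) ^ (1 / p) := by linarith
      have h2 : (t * r) ^ 2 ≤ (∑ i, W i ω ^ p) ^ (2 / p) := by
        calc (t * r) ^ 2 ≤ ((∑ i, W i ω ^ p) ^ (1 / p)) ^ 2 := by gcongr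
          _ = _ := by
            rw [← Real.rpow_two, ← Real.rpow_mul hsum]
            congr 1
            ring
      have h3 := Real.rpow_sum_le_const_mul_sum_rpow_of_nonneg (s := Finset.univ)
        (f := fun i => W i ω ^ p) (p := 2 / p) (by rw [le_div_iff₀ (by linarith)]; linarith)
        fun i _ => hWp i ω
      have h4 : ∀ i, (W i ω ^ p) ^ (2 / p) = W i ω ^ 2 := fun i => by
        rw [← Real.rpow_mul (h.nonneg i ω), mul_div_cancel₀ _ (by linarith), Real.rpow_two]
      simp only [h4, Finset.card_univ, Fintype.card_fin] at h3
      have h5 : (m : ℝ) ^ (2 / p - 1) ≤ r ^ 2 := by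
        calc (m : ℝ) ^ (2 / p - 1) = ((m : ℝ) ^ (1 / p - 1 / 2)) ^ 2 := by
              rw [← Real.rpow_two, ← Real.rpow_mul hN.le]
              congr 1
              ring
          _ ≤ r ^ 2 := by gcongr
      have hsum2 : 0 ≤ ∑ i, W i ω ^ 2 := Finset.sum_nonneg fun i _ => sq_nonneg _
      have h6 : (t * r) ^ 2 ≤ r ^ 2 * ∑ i, W i ω ^ 2 :=
        (h2.trans h3).trans (by gcongr)
      have hr2 : 0 < r ^ 2 := by positivity
      rw [mul_pow, mul_comm] at h6
      exact le_of_mul_le_mul_left h6 hr2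
    refine (measureReal_mono hsub).trans ((h.measure_sum_sq_ge_le _).trans
      (Real.exp_le_exp.2 ?_))
    have h1 : 4 * (m : ℝ) ≤ t ^ 2 := by
      calc 4 * (m : ℝ) = (2 * Real.sqrt m) ^ 2 := by rw [mul_pow, hsq]; norm_num
        _ ≤ t ^ 2 := by gcongr
    have h2 : (δ * t) ^ 2 ≤ t ^ 2 := by
      have : δ * t ≤ t := by nlinarith
      gcongr
    nlinarith [sq_nonneg t, sq_nonneg (δ * t)]

/-- Chernoff's bound for the powers `W i ^ p`, `p ≥ 2`, truncated at level `u`. -/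
lemma measure_sum_truncated_ge_le (h : IsNormalizedFamily W p s μ) (hm : 0 < m)
    (hp2 : 2 ≤ p) (hB0 : 0 < B)
    (hB : ∀ w : ℝ, 0 ≤ w → w ^ (2 * p) ≤ B * Real.exp (w ^ 2 / 2))
    (hc0 : 0 < c) (hc : c ≤ 1 / 8) (hcB : c * (8 * B) ≤ 1) {u : ℝ} (hu0 : 0 < u) :
    μ.real {ω | m * s ^ p + u ≤ ∑ i, if W i ω ^ p ≤ u then W i ω ^ p else 0} ≤
      Real.exp (-(c / 2 * min (u ^ 2 / m) ((u ^ (1 / p)) ^ 2))) := by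
  have hN : (0 : ℝ) < m := by exact_mod_cast hm
  have hp0 : 0 < p := by linarith
  have hw02 : u ^ (2 / p - 1) * u = (u ^ (1 / p)) ^ 2 := by
    rw [← Real.rpow_add_one hu0.ne', ← Real.rpow_two, ← Real.rpow_mul hu0.le]
    congr 1
    ring
  have hmin : min (u / m) (u ^ (2 / p - 1)) * u = min (u ^ 2 / m) ((u ^ (1 / p)) ^ 2) := by
    rw [min_mul_of_nonneg _ _ hu0.le, hw02, div_mul_eq_mul_div, ← sq]
  -- The bound `u/m` keeps the quadratic Chernoff term below half the linear one. The bound `u^(2/p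
  -- - 1)` gives `l w^p ≤ c w²` whenever `w^p ≤ u`, because the exponent `2/p - 1` is nonpositive.
  obtain ⟨l, hl⟩ : ∃ l, l = c * min (u / m) (u ^ (2 / p - 1)) := ⟨_, rfl⟩
  have hl0 : 0 ≤ l := by rw [hl]; positivity
  have hlw : ∀ w : ℝ, 0 ≤ w → l * (if w ^ p ≤ u then w ^ p else 0) ≤ (1 + w ^ 2) / 4 := by
    intro w hw
    have hle : l * (if w ^ p ≤ u then w ^ p else 0) ≤ c * w ^ 2 := by
      split_ifs with hwu
      · rcases hw.eq_or_lt with rfl | hw'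
        · rw [Real.zero_rpow hp0.ne']; simp
        have h1 : u ^ (2 / p - 1) ≤ (w ^ p) ^ (2 / p - 1) := by
          refine Real.rpow_le_rpow_of_nonpos (by positivity) hwu ?_
          rw [sub_nonpos, div_le_one hp0]
          exact hp2
        have h2 : (w ^ p) ^ (2 / p - 1) * w ^ p = w ^ 2 := by
          rw [← Real.rpow_add_one (by positivity), sub_add_cancel, ← Real.rpow_mul hw,
            mul_div_cancel₀ _ hp0.ne', Real.rpow_two]
        have h3 : l ≤ c * (w ^ p) ^ (2 / p - 1) := by
          rw [hl]
          exact mul_le_mul_of_nonneg_left ((min_le_right _ _).trans h1) hc0.le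
        calc l * w ^ p ≤ c * (w ^ p) ^ (2 / p - 1) * w ^ p :=
              mul_le_mul_of_nonneg_right h3 (by positivity)
          _ = _ := by rw [mul_assoc, h2]
      · simp only [mul_zero]; positivity
    have h4 : c * w ^ 2 ≤ 1 / 8 * w ^ 2 := mul_le_mul_of_nonneg_right hc (sq_nonneg w)
    linarith [sq_nonneg w]
  have hmain := h.measure_sum_ge_le (by linarith) hB0 hB
    (g := fun w => if w ^ p ≤ u then w ^ p else 0)
    (Measurable.ite (measurableSet_le (by fun_prop) measurable_const) (by fun_prop)
      measurable_const)
    (fun w hw => by split_ifs <;> positivity)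
    (fun w hw => by
      split_ifs
      · exact le_rfl
      · positivity)
    hl0 hlw u
  refine hmain.trans (Real.exp_le_exp.2 ?_)
  have h1 : l * m ≤ c * u := by
    calc l * m ≤ c * (u / m) * m := by
          rw [hl]
          exact mul_le_mul_of_nonneg_right
            (mul_le_mul_of_nonneg_left (min_le_left _ _) hc0.le) hN.le
      _ = _ := by field_simp
  have h2 : l ^ 2 * (4 * B) * m ≤ l * u / 2 := by
    calc l ^ 2 * (4 * B) * m = l * (l * m) * (4 * B) := by ring
      _ ≤ l * (c * u) * (4 * B) := by gcongr
      _ = (c * (8 * B)) * (l * u / 2) := by ring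
      _ ≤ 1 * (l * u / 2) := by gcongr
      _ = _ := one_mul _
  have h3 : c * min (u ^ 2 / m) ((u ^ (1 / p)) ^ 2) = l * u := by
    rw [hl, mul_assoc, hmin]
  linarith

/-- Half of the exponent in the tail `2 exp (-w²)` pays for the union bound, since `m ≤ w^(2p) ≤ B
exp (w²/2)`. -/
lemma measure_iUnion_sq_ge_le (h : IsNormalizedFamily W p s μ) {w : ℝ} (hw : 0 ≤ w)
    (hB : ∀ w : ℝ, 0 ≤ w → w ^ (2 * p) ≤ B * Real.exp (w ^ 2 / 2))
    (hmw : (m : ℝ) ≤ w ^ (2 * p)) :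
    μ.real (⋃ i, {ω | w ^ 2 ≤ W i ω ^ 2}) ≤ 2 * B * Real.exp (-(w ^ 2 / 2)) := by
  refine (measureReal_iUnion_fintype_le _).trans ?_
  refine (Finset.sum_le_sum fun i _ => h.measure_sq_ge_le i (w ^ 2)).trans ?_
  rw [Finset.sum_const, Finset.card_univ, Fintype.card_fin, nsmul_eq_mul]
  have h1 : (m : ℝ) ≤ B * Real.exp (w ^ 2 / 2) := hmw.trans (hB w hw)
  calc (m : ℝ) * (2 * Real.exp (-w ^ 2))
      ≤ (B * Real.exp (w ^ 2 / 2)) * (2 * Real.exp (-w ^ 2)) := by gcongr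
    _ = 2 * B * (Real.exp (w ^ 2 / 2) * Real.exp (-w ^ 2)) := by ring
    _ = _ := by rw [← Real.exp_add]; congr 2; ring

/-- For `p > 2` the powers `W_i^p` need not have exponential moments. Either some coordinate reaches
the level `w₀ = u^(1/p)`, or the truncated powers have the same sum and their Chernoff bound
applies. -/
lemma measure_upper_tail_le_of_two_le (h : IsNormalizedFamily W p s μ) (hm : 0 < m)
    (hp2 : 2 ≤ p) (hs : 0 ≤ s) (hB0 : 0 < B)
    (hB : ∀ w : ℝ, 0 ≤ w → w ^ (2 * p) ≤ B * Real.exp (w ^ 2 / 2))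
    (hc0 : 0 < c) (hc : c ≤ 1 / 8) (hcB : c * (8 * B) ≤ 1)
    (hδ0 : 0 ≤ δ) (hδ1 : δ ≤ 1) (hδ : δ ≤ s ^ (p - 1)) (hr1 : 1 ≤ r) (ht : 0 ≤ t) :
    μ.real {ω | (m : ℝ) ^ (1 / p) * s + t * r ≤ (∑ i, W i ω ^ p) ^ (1 / p)} ≤
      (3 + 2 * B) * Real.exp (-(c / 2 * (δ * t) ^ 2)) := by
  have hprob : IsProbabilityMeasure μ := h.indep.isProbabilityMeasure
  have hN : (0 : ℝ) < m := by exact_mod_cast hm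
  have hN1 : (1 : ℝ) ≤ m := by exact_mod_cast hm
  have hp : 1 ≤ p := by linarith
  have hp0 : 0 < p := by linarith
  have hWp : ∀ i ω, 0 ≤ W i ω ^ p := fun i ω => by have := h.nonneg i ω; positivity
  -- For `δ t ≤ 1` the right-hand side already exceeds 1. Otherwise `δ t > 1` will give `m ≤ u²`, as
  -- the union bound requires.
  rcases le_or_gt (δ * t) 1 with hδt | hδt
  · refine measureReal_le_one.trans ?_
    have h1 : (δ * t) ^ 2 ≤ 1 := pow_le_one₀ (by positivity) hδt
    have h2 := Real.add_one_le_exp (-(c / 2 * (δ * t) ^ 2))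
    nlinarith [Real.exp_pos (-(c / 2 * (δ * t) ^ 2))]
  have ht1 : 1 ≤ t := by nlinarith
  -- Both terms bound the excess of `∑ W_i^p` over `m s^p` from below: one by the slope at the
  -- centre, the other by superadditivity of the power. The first yields `u²/m ≥ (δ t)²`, the second
  -- `w₀ ≥ t`.
  set u : ℝ := max (δ * (m : ℝ) ^ ((p - 1) / p) * t) (t ^ p) with hu
  have hu1 : δ * (m : ℝ) ^ ((p - 1) / p) * t ≤ u := le_max_left _ _
  have hu2 : t ^ p ≤ u := le_max_right _ _
  have hsqrt : Real.sqrt m ≤ (m : ℝ) ^ ((p - 1) / p) := by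
    rw [Real.sqrt_eq_rpow]
    refine Real.rpow_le_rpow_of_exponent_le hN1 ?_
    rw [div_le_div_iff₀ (by norm_num) hp0]
    linarith
  have hsq0 : 0 < Real.sqrt m := Real.sqrt_pos.2 hN
  have hsq : Real.sqrt m ^ 2 = m := Real.sq_sqrt hN.le
  have hu3 : (δ * t) * Real.sqrt m ≤ u := by
    refine le_trans ?_ hu1
    nlinarith [mul_nonneg hδ0 ht]
  have hu0 : 0 < u := by nlinarith
  have hmu : (m : ℝ) ≤ u ^ 2 := by
    rw [← hsq]
    have : Real.sqrt m ≤ u := by nlinarith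
    gcongr
  set w₀ : ℝ := u ^ (1 / p) with hw₀
  have hw0 : 0 < w₀ := by positivity
  have hw0p : w₀ ^ p = u := by
    rw [hw₀, ← Real.rpow_mul hu0.le, one_div, inv_mul_cancel₀ hp0.ne', Real.rpow_one]
  have htw : t ≤ w₀ := by
    rw [← Real.rpow_le_rpow_iff ht hw0.le hp0, hw0p]
    exact hu2
  have hsub : {ω | (m : ℝ) ^ (1 / p) * s + t * r ≤ (∑ i, W i ω ^ p) ^ (1 / p)} ⊆
      (⋃ i, {ω | w₀ ^ 2 ≤ W i ω ^ 2}) ∪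
        {ω | m * s ^ p + u ≤ ∑ i, if W i ω ^ p ≤ u then W i ω ^ p else 0} := by
    intro ω hω
    simp only [Set.mem_ofPred_eq] at hω
    by_cases hex : ∃ i, w₀ ^ 2 ≤ W i ω ^ 2
    · exact Or.inl (Set.mem_iUnion.2 hex)
    right
    push Not at hex
    have hgW : ∀ i, (if W i ω ^ p ≤ u then W i ω ^ p else 0) = W i ω ^ p := fun i => by
      have h1 : W i ω ≤ w₀ := (lt_of_pow_lt_pow_left₀ 2 hw0.le (hex i)).le
      have h2 : W i ω ^ p ≤ u := by
        rw [← hw0p]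
        exact Real.rpow_le_rpow (h.nonneg i ω) h1 hp0.le
      rw [if_pos h2]
    simp only [Set.mem_ofPred_eq, hgW]
    have hsum : 0 ≤ ∑ i, W i ω ^ p := Finset.sum_nonneg fun i _ => hWp i ω
    have hb : 0 ≤ (m : ℝ) ^ (1 / p) * s := by positivity
    have hωt : (m : ℝ) ^ (1 / p) * s + t ≤ (∑ i, W i ω ^ p) ^ (1 / p) := by nlinarith
    have h1 := rpow_add_mul_le_of_add_le hb ht hp hωt
    have h2 := rpow_add_rpow_le_of_add_le hb ht hp hωt
    rw [rpow_one_div_mul_rpow hN.le hs hp, rpow_one_div_rpow_self hsum hp] at h1 h2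
    rw [rpow_one_div_mul_rpow_sub_one hN.le hs] at h1
    have h3 : δ * (m : ℝ) ^ ((p - 1) / p) * t ≤ (m : ℝ) ^ ((p - 1) / p) * s ^ (p - 1) * t := by
      rw [mul_comm δ]; gcongr
    have h4 : u ≤ ∑ i, W i ω ^ p - m * s ^ p := max_le (by linarith) (by linarith)
    linarith
  have hunion := h.measure_iUnion_sq_ge_le hw0.le hB (by
    rwa [mul_comm 2 p, Real.rpow_mul hw0.le, hw0p, Real.rpow_two])
  have hmain := h.measure_sum_truncated_ge_le hm hp2 hB0 hB hc0 hc hcB hu0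
  have hexp : -(c / 2 * min (u ^ 2 / m) (w₀ ^ 2)) ≤ -(c / 2 * (δ * t) ^ 2) := by
    refine neg_le_neg (mul_le_mul_of_nonneg_left (le_min ?_ ?_) (by positivity))
    · rw [le_div_iff₀ hN]
      calc (δ * t) ^ 2 * m = (δ * t * Real.sqrt m) ^ 2 := by rw [mul_pow _ (Real.sqrt m), hsq]
        _ ≤ u ^ 2 := by gcongr
    · have : δ * t ≤ w₀ := by nlinarith
      gcongr
  have hexp2 : -(w₀ ^ 2 / 2) ≤ -(c / 2 * (δ * t) ^ 2) := by
    have h1 : (δ * t) ^ 2 ≤ w₀ ^ 2 := by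
      have : δ * t ≤ w₀ := by nlinarith
      gcongr
    nlinarith [sq_nonneg w₀, sq_nonneg (δ * t)]
  refine (measureReal_mono hsub).trans ((measureReal_union_le _ _).trans ?_)
  have k1 := Real.exp_le_exp.2 hexp
  have k2 := mul_le_mul_of_nonneg_left (Real.exp_le_exp.2 hexp2) (by positivity : 0 ≤ 2 * B)
  have k3 := Real.exp_pos (-(c / 2 * (δ * t) ^ 2))
  linarith

/-- Concentration of the `ℓ_p` norm of a vector with independent sub-Gaussian coordinates. -/
lemma measure_abs_sub_ge_le (h : IsNormalizedFamily W p s μ) (hm : 0 < m) (hp : 1 ≤ p)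
    (hs : 0 ≤ s) (hB0 : 0 < B) (hB : ∀ w : ℝ, 0 ≤ w → w ^ (2 * p) ≤ B * Real.exp (w ^ 2 / 2))
    (hc0 : 0 < c) (hc : c ≤ 1 / 8) (hcB : c * (8 * B) ≤ 1)
    (hδ0 : 0 ≤ δ) (hδ1 : δ ≤ 1) (hδ : δ ≤ s ^ (p - 1))
    (hr1 : 1 ≤ r) (hr : (m : ℝ) ^ (1 / p - 1 / 2) ≤ r) (ht : 0 ≤ t) :
    μ.real {ω | t * r ≤ |(∑ i, W i ω ^ p) ^ (1 / p) - (m : ℝ) ^ (1 / p) * s|} ≤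
      (4 + 2 * B) * Real.exp (-(c / 2 * (δ * t) ^ 2)) := by
  have hprob : IsProbabilityMeasure μ := h.indep.isProbabilityMeasure
  have hsub : {ω | t * r ≤ |(∑ i, W i ω ^ p) ^ (1 / p) - (m : ℝ) ^ (1 / p) * s|} ⊆
      {ω | (m : ℝ) ^ (1 / p) * s + t * r ≤ (∑ i, W i ω ^ p) ^ (1 / p)} ∪
      {ω | (∑ i, W i ω ^ p) ^ (1 / p) + t * r ≤ (m : ℝ) ^ (1 / p) * s} := by
    intro ω hω
    simp only [Set.mem_ofPred_eq] at hω
    rcases le_abs.1 hω with h1 | h1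
    · left; simp only [Set.mem_ofPred_eq]; linarith
    · right; simp only [Set.mem_ofPred_eq]; linarith
  refine (measureReal_mono hsub).trans ((measureReal_union_le _ _).trans ?_)
  have hpos := Real.exp_pos (-(c / 2 * (δ * t) ^ 2))
  have hup : μ.real {ω | (m : ℝ) ^ (1 / p) * s + t * r ≤ (∑ i, W i ω ^ p) ^ (1 / p)} ≤
      (3 + 2 * B) * Real.exp (-(c / 2 * (δ * t) ^ 2)) := by
    rcases le_total p 2 with hp2 | hp2
    · refine (h.measure_upper_tail_le_of_le_two hm hp hp2 hs hB0 hB hc0 hc hcB hδ0 hδ1 hδ hr1 hr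
        ht).trans ?_
      nlinarith
    · exact h.measure_upper_tail_le_of_two_le hm hp2 hs hB0 hB hc0 hc hcB hδ0 hδ1 hδ hr1 ht
  have hlow := h.measure_lower_tail_le hm hp hs hB0 hB hδ0 hδ (by linarith : 0 ≤ r) hr ht
  have hle : Real.exp (-(1 / (8 * B) * (δ * t) ^ 2)) ≤ Real.exp (-(c / 2 * (δ * t) ^ 2)) := by
    refine Real.exp_le_exp.2 (neg_le_neg ?_)
    refine mul_le_mul_of_nonneg_right ?_ (sq_nonneg _)
    rw [le_div_iff₀ (by positivity)]
    nlinarith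
  linarith

end IsNormalizedFamily

/-! ### Sub-Gaussian linear combinations and a lower bound for moments -/

/-- The linear term integrates to zero for a centered variable, leaving only the exponential of a
square. -/
lemma exp_le_add_exp_sq (y : ℝ) : Real.exp y ≤ y + Real.exp (y ^ 2) := by
  have h1 := Real.add_one_le_exp (y ^ 2)
  rcases le_or_gt |y| 1 with hy | hy
  · have h := (abs_le.1 (Real.abs_exp_sub_one_sub_id_le hy)).2
    linarith
  · rcases lt_abs.1 hy with hy | hy
    · have : Real.exp y ≤ Real.exp (y ^ 2) := Real.exp_le_exp.2 (by nlinarith)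
      linarith
    · have : Real.exp y ≤ 1 := Real.exp_le_one_iff.2 (by linarith)
      nlinarith

/-- A centered variable with a `ψ₂` bound has a sub-Gaussian moment generating function. -/
lemma HasPsiTwoBound.hasSubgaussianMGF [IsProbabilityMeasure μ] {X : Ω → ℝ} {k : ℝ} (hk : 0 < k)
    (hX : AEMeasurable X μ) (h : HasPsiTwoBound X k μ) (h0 : ∫ ω, X ω ∂μ = 0) :
    HasSubgaussianMGF X (2 * Real.toNNReal k ^ 2) μ := by
  have hf : AEMeasurable (fun ω => X ω ^ 2 / k ^ 2) μ := (hX.pow_const 2).div_const _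
  have hXi : Integrable X μ := (h.memLp_two hk hX).integrable (by norm_num)
  have hhalf := integrable_exp_mul_of_integrable hf (θ := 1 / 2) (by norm_num) (by norm_num)
    h.integrable
  have hpt : ∀ l ω, Real.exp (l * X ω) ≤
      Real.exp (k ^ 2 * l ^ 2 / 2) * Real.exp (1 / 2 * (X ω ^ 2 / k ^ 2)) := by
    intro l ω
    rw [← Real.exp_add]
    refine Real.exp_le_exp.2 ?_
    have : k ^ 2 * l ^ 2 / 2 + 1 / 2 * (X ω ^ 2 / k ^ 2) - l * X ω =
        (k * l - X ω / k) ^ 2 / 2 := by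
      field_simp
      ring
    nlinarith [sq_nonneg (k * l - X ω / k)]
  have hint : ∀ l : ℝ, Integrable (fun ω => Real.exp (l * X ω)) μ := fun l => by
    refine Integrable.mono' (hhalf.const_mul (Real.exp (k ^ 2 * l ^ 2 / 2)))
      (Real.measurable_exp.comp_aemeasurable (hX.const_mul l)).aestronglyMeasurable
      (Filter.Eventually.of_forall fun ω => ?_)
    rw [Real.norm_of_nonneg (Real.exp_pos _).le]
    exact hpt l ω
  refine ⟨hint, fun l => ?_⟩
  have hc : ((2 * Real.toNNReal k ^ 2 : ℝ≥0) : ℝ) * l ^ 2 / 2 = k ^ 2 * l ^ 2 := by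
    push_cast
    rw [Real.coe_toNNReal k hk.le]
    ring
  rw [hc, mgf]
  have hθ0 : 0 ≤ k ^ 2 * l ^ 2 := by positivity
  -- For `k² l² ≤ 1`, centering and convexity with `θ = k² l²` give at most `1 + k² l²`. Otherwise
  -- Young's inequality `hpt` suffices: the extra factor is at most `3/2 ≤ exp (1/2)`, and `1/2 ≤ k²
  -- l²/2`.
  rcases le_or_gt (k ^ 2 * l ^ 2) 1 with hθ | hθ
  · have heq : ∀ ω, (l * X ω) ^ 2 = k ^ 2 * l ^ 2 * (X ω ^ 2 / k ^ 2) := fun ω => by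
      field_simp
    have hi := integrable_exp_mul_of_integrable hf hθ0 hθ h.integrable
    have h1 : ∫ ω, Real.exp (l * X ω) ∂μ ≤
        ∫ ω, (l * X ω + Real.exp (k ^ 2 * l ^ 2 * (X ω ^ 2 / k ^ 2))) ∂μ :=
      integral_mono (hint l) ((hXi.const_mul l).add hi) fun ω => by
        simp only
        rw [← heq]
        exact exp_le_add_exp_sq _
    rw [integral_add (hXi.const_mul l) hi, integral_const_mul, h0, mul_zero, zero_add] at h1
    have h2 := integral_exp_mul_le hf hθ0 hθ h.integrable
    have h3 := mul_le_mul_of_nonneg_left h.integral_le hθ0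
    have h4 := Real.add_one_le_exp (k ^ 2 * l ^ 2)
    linarith
  · have h1 := integral_mono (hint l) (hhalf.const_mul _) (hpt l)
    rw [integral_const_mul] at h1
    have h2 := integral_exp_mul_le hf (θ := 1 / 2) (by norm_num) (by norm_num) h.integrable
    have h3 : ∫ ω, Real.exp (1 / 2 * (X ω ^ 2 / k ^ 2)) ∂μ ≤ Real.exp (1 / 2) := by
      have := Real.add_one_le_exp (1 / 2 : ℝ)
      linarith [h.integral_le]
    calc ∫ ω, Real.exp (l * X ω) ∂μ
        ≤ Real.exp (k ^ 2 * l ^ 2 / 2) * Real.exp (1 / 2) := h1.trans (by gcongr)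
      _ = Real.exp (k ^ 2 * l ^ 2 / 2 + 1 / 2) := (Real.exp_add _ _).symm
      _ ≤ _ := Real.exp_le_exp.2 (by linarith)

/-- `ψ₂` bound for a linear combination of independent centered variables. -/
lemma hasPsiTwoBound_sum_mul {ι : Type*} [Fintype ι] {X : ι → Ω → ℝ} {k : ℝ} (hk : 0 < k)
    (hX : ∀ j, Measurable (X j)) (hind : iIndepFun X μ) (h : ∀ j, HasPsiTwoBound (X j) k μ)
    (h0 : ∀ j, ∫ ω, X j ω ∂μ = 0) (x : ι → ℝ) {E : ℝ} (hE : 0 < E) (hEx : ∑ j, x j ^ 2 = E ^ 2) :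
    HasPsiTwoBound (fun ω => ∑ j, x j * X j ω) (4 * k * E) μ := by
  have hprob : IsProbabilityMeasure μ := hind.isProbabilityMeasure
  have hterm : ∀ j, HasSubgaussianMGF (fun ω => x j * X j ω)
      (Real.toNNReal (x j ^ 2) * (2 * Real.toNNReal k ^ 2)) μ := fun j => by
    rw [Real.toNNReal_of_nonneg (sq_nonneg (x j))]
    exact ((h j).hasSubgaussianMGF hk (hX j).aemeasurable (h0 j)).const_mul (x j)
  have hsum := HasSubgaussianMGF.sum_of_iIndepFun (s := Finset.univ)
    (hind.comp (fun j y => x j * y) fun j => by fun_prop) fun j _ => hterm j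
  simp only [Function.comp_apply] at hsum
  obtain ⟨C, hC⟩ : ∃ C, C = ∑ j, Real.toNNReal (x j ^ 2) * (2 * Real.toNNReal k ^ 2) := ⟨_, rfl⟩
  rw [← hC] at hsum
  -- This variance proxy makes the tail at `2kE t` equal to `exp (-t²)` on each side; the two sides
  -- give `M = 2`, and `√(2M) · 2kE = 4kE`.
  have hCv : (C : ℝ) = 2 * k ^ 2 * E ^ 2 := by
    rw [hC]
    push_cast
    simp only [Real.coe_toNNReal k hk.le, ← Finset.sum_mul, Real.coe_toNNReal _ (sq_nonneg _)]
    rw [hEx]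
    ring
  have htail : ∀ t > 0, μ.real {ω | t * (2 * k * E) ≤ |∑ j, x j * X j ω|} ≤
      2 * Real.exp (-t ^ 2) := by
    intro t ht
    have hsub : {ω | t * (2 * k * E) ≤ |∑ j, x j * X j ω|} ⊆
        {ω | t * (2 * k * E) ≤ ∑ j, x j * X j ω} ∪
        {ω | t * (2 * k * E) ≤ (-fun ω => ∑ j, x j * X j ω) ω} := by
      intro ω hω
      simp only [Set.mem_ofPred_eq, Set.mem_union, Pi.neg_apply] at hω ⊢
      exact le_abs.1 hω
    have hexp : -(t * (2 * k * E)) ^ 2 / (2 * C) = -t ^ 2 := by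
      rw [hCv]
      field_simp
    have h1 := hsum.measure_ge_le (ε := t * (2 * k * E)) (by positivity)
    have h2 := hsum.neg.measure_ge_le (ε := t * (2 * k * E)) (by positivity)
    rw [hexp] at h1 h2
    refine (measureReal_mono hsub).trans ((measureReal_union_le _ _).trans ?_)
    linarith
  have := hasPsiTwoBound_of_tail (M := 2) (by norm_num) (by positivity : 0 < 2 * k * E)
    (by fun_prop) htail
  have h4 : Real.sqrt (2 * 2) = 2 := by
    rw [Real.sqrt_mul_self (by norm_num)]
  rw [h4] at this
  convert this using 1
  ring

/-- Lower bound for the first absolute moment in terms of the second moment and a `ψ₂` bound. -/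
lemma HasPsiTwoBound.le_integral_abs [IsProbabilityMeasure μ] {Y : Ω → ℝ} {L E : ℝ} (hL : 0 < L)
    (hE : 0 < E) (hY : AEMeasurable Y μ) (h : HasPsiTwoBound Y L μ)
    (h2 : ∫ ω, Y ω ^ 2 ∂μ = E ^ 2) : E ^ 3 / (6 * L ^ 2) ≤ ∫ ω, |Y ω| ∂μ := by
  have hYi : Integrable Y μ := (h.memLp_two hL hY).integrable (by norm_num)
  -- Split at `|Y| = 3L²/E`. Above it, `Y² ≤ (E²/9)(Y²/L²)²`, and `v² ≤ 2 exp v`. The exponential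
  -- part integrates to at most `4E²/9 < E²/2`, so the part linear in `|Y|` carries at least half of
  -- `𝔼 Y²`.
  have hpt : ∀ ω, Y ω ^ 2 ≤ 3 * L ^ 2 / E * |Y ω| +
      2 * E ^ 2 / 9 * Real.exp (Y ω ^ 2 / L ^ 2) := by
    intro ω
    have hab : 0 ≤ |Y ω| := abs_nonneg _
    rcases le_total |Y ω| (3 * L ^ 2 / E) with hy | hy
    · have h3 : Y ω ^ 2 ≤ 3 * L ^ 2 / E * |Y ω| := by
        rw [← sq_abs, sq]; gcongr
      have : 0 ≤ 2 * E ^ 2 / 9 * Real.exp (Y ω ^ 2 / L ^ 2) := by positivity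
      linarith
    · have h3 : (Y ω ^ 2 / L ^ 2) ^ 2 ≤ 2 * Real.exp (Y ω ^ 2 / L ^ 2) := by
        have := Real.quadratic_le_exp_of_nonneg (by positivity : 0 ≤ Y ω ^ 2 / L ^ 2)
        have : 0 ≤ Y ω ^ 2 / L ^ 2 := by positivity
        linarith
      have h4 : (3 * L ^ 2 / E) ^ 2 ≤ Y ω ^ 2 := by
        rw [← sq_abs (Y ω)]; gcongr
      have h5 : Y ω ^ 2 ≤ E ^ 2 / 9 * (Y ω ^ 2 / L ^ 2) ^ 2 := by
        have e : E ^ 2 / 9 * (Y ω ^ 2 / L ^ 2) ^ 2 =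
            Y ω ^ 2 * (Y ω ^ 2 / (3 * L ^ 2 / E) ^ 2) := by
          field_simp
          ring
        rw [e]
        refine le_mul_of_one_le_right (sq_nonneg _) ?_
        rwa [one_le_div (by positivity)]
      have h6 : E ^ 2 / 9 * (Y ω ^ 2 / L ^ 2) ^ 2 ≤
          E ^ 2 / 9 * (2 * Real.exp (Y ω ^ 2 / L ^ 2)) := by gcongr
      have : 0 ≤ 3 * L ^ 2 / E * |Y ω| := by positivity
      linarith
  have hI := integral_mono (h.integrable_sq hL hY)
    ((hYi.abs.const_mul (3 * L ^ 2 / E)).add (h.integrable.const_mul (2 * E ^ 2 / 9))) hpt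
  simp only [Pi.add_apply] at hI
  rw [integral_add (hYi.abs.const_mul _) (h.integrable.const_mul _), integral_const_mul,
    integral_const_mul, h2] at hI
  have h7 : 2 * E ^ 2 / 9 * ∫ ω, Real.exp (Y ω ^ 2 / L ^ 2) ∂μ ≤ 2 * E ^ 2 / 9 * 2 := by
    gcongr
    exact h.integral_le
  have h8 : E ^ 2 / 2 ≤ 3 * L ^ 2 / E * ∫ ω, |Y ω| ∂μ := by nlinarith [sq_nonneg E]
  rw [div_mul_eq_mul_div, le_div_iff₀ hE] at h8
  rw [div_le_iff₀ (by positivity)]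
  nlinarith

lemma integral_abs_le_rpow_integral [IsProbabilityMeasure μ] {Y : Ω → ℝ} {p : ℝ} (hp : 1 ≤ p)
    (hY : Integrable Y μ) (hYp : Integrable (fun ω => |Y ω| ^ p) μ) :
    ∫ ω, |Y ω| ∂μ ≤ (∫ ω, |Y ω| ^ p ∂μ) ^ (1 / p) := by
  have h := (convexOn_rpow hp).map_integral_le (f := fun ω => |Y ω|) (μ := μ)
    (Real.continuous_rpow_const (by linarith)).continuousOn isClosed_Ici
    (Filter.Eventually.of_forall fun ω => Set.mem_Ici.2 (abs_nonneg _)) hY.abs hYp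
  have h0 : 0 ≤ ∫ ω, |Y ω| ∂μ := integral_nonneg fun ω => abs_nonneg _
  rw [one_div, Real.le_rpow_inv_iff_of_pos h0 (integral_nonneg fun ω => by positivity)
    (by linarith)]
  exact h

/-! ### The products `⟨A_i, x⟩`: independence, common law, second moment -/

/-- The rows of a matrix with independent entries are independent. -/
lemma iIndepFun_rows {m n : ℕ} {A : Ω → Matrix (Fin m) (Fin n) ℝ}
    (hA : ∀ i j, Measurable fun ω => A ω i j)
    (hind : iIndepFun (fun (ij : Fin m × Fin n) ω => A ω ij.1 ij.2) μ) :
    iIndepFun (fun i ω j => A ω i j) μ := by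
  have hprob : IsProbabilityMeasure μ := hind.isProbabilityMeasure
  have hmarg : ∀ i j, IsProbabilityMeasure (μ.map fun ω => A ω i j) := fun i j =>
    Measure.isProbabilityMeasure_map (hA i j).aemeasurable
  have hrow : ∀ i, μ.map (fun ω j => A ω i j) =
      Measure.infinitePi fun j => μ.map fun ω => A ω i j := fun i =>
    (iIndepFun_iff_map_fun_eq_infinitePi_map fun j => hA i j).1
      (hind.precomp (g := fun j : Fin n => (i, j)) fun j j' hjj => by simpa using hjj)
  -- Independence says that the joint law is a product measure. Currying the product over pairs
  -- gives the product over rows of the row laws.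
  rw [iIndepFun_iff_map_fun_eq_infinitePi_map fun i => measurable_pi_iff.2 fun j => hA i j]
  simp_rw [hrow]
  rw [← Measure.infinitePi_map_curry fun i j => μ.map fun ω => A ω i j,
    ← (iIndepFun_iff_map_fun_eq_infinitePi_map fun ij : Fin m × Fin n => hA ij.1 ij.2).1 hind,
    Measure.map_map (MeasurableEquiv.measurable _)
      (measurable_pi_iff.2 fun ij : Fin m × Fin n => hA ij.1 ij.2)]
  rfl

namespace IsSubGaussianEnsemble

variable {m n : ℕ} {A : Ω → Matrix (Fin m) (Fin n) ℝ}

lemma row_indep (h : IsSubGaussianEnsemble A μ) (i : Fin m) :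
    iIndepFun (fun j ω => A ω i j) μ :=
  h.indep.precomp (g := fun j : Fin n => (i, j)) fun j j' hjj => by simpa using hjj

lemma measurable_dotProduct (h : IsSubGaussianEnsemble A μ) (x : Fin n → ℝ) (i : Fin m) :
    Measurable fun ω => A ω i ⬝ᵥ x := by
  simp only [dotProduct]
  exact Finset.measurable_sum _ fun j _ => (h.measurable i j).mul_const _

lemma iIndepFun_dotProduct (h : IsSubGaussianEnsemble A μ) (x : Fin n → ℝ) :
    iIndepFun (fun i ω => A ω i ⬝ᵥ x) μ :=
  (iIndepFun_rows h.measurable h.indep).comp (fun _ v => v ⬝ᵥ x) fun _ => by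
    simp only [dotProduct]; fun_prop

lemma identDistrib_dotProduct (h : IsSubGaussianEnsemble A μ) (x : Fin n → ℝ) (i i' : Fin m) :
    IdentDistrib (fun ω => A ω i ⬝ᵥ x) (fun ω => A ω i' ⬝ᵥ x) μ μ :=
  (IdentDistrib.pi (fun j => h.identDistrib i j i' j) (h.row_indep i) (h.row_indep i')).comp
    (u := fun v => v ⬝ᵥ x) (by simp only [dotProduct]; fun_prop)

lemma hasPsiTwoBound_dotProduct (h : IsSubGaussianEnsemble A μ) {k : ℝ} (hk : 0 < k)
    (hA : ∀ i j, HasPsiTwoBound (fun ω => A ω i j) k μ) {x : Fin n → ℝ} {E : ℝ} (hE : 0 < E)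
    (hx : ∑ j, x j ^ 2 = E ^ 2) (i : Fin m) :
    HasPsiTwoBound (fun ω => A ω i ⬝ᵥ x) (4 * k * E) μ := by
  have := hasPsiTwoBound_sum_mul hk (h.measurable i) (h.row_indep i) (hA i) (h.mean_zero i) x hE hx
  simpa only [dotProduct, mul_comm (x _)] using this

lemma integral_dotProduct_sq [IsProbabilityMeasure μ] (h : IsSubGaussianEnsemble A μ)
    (hL2 : ∀ i j, MemLp (fun ω => A ω i j) 2 μ) (x : Fin n → ℝ) (i : Fin m) :
    ∫ ω, (A ω i ⬝ᵥ x) ^ 2 ∂μ = ∑ j, x j ^ 2 := by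
  have hm : ∀ j, MemLp (fun ω => A ω i j * x j) 2 μ := fun j => (hL2 i j).mul_const (x j)
  have hv := IndepFun.variance_sum (s := Finset.univ) (fun j _ => hm j) fun j _ j' _ hjj =>
    ((h.row_indep i).comp (fun j y => y * x j) fun j => by fun_prop).indepFun hjj
  have hvar : ∀ j, variance (fun ω => A ω i j * x j) μ = x j ^ 2 := fun j => by
    have := variance_const_mul (x j) (fun ω => A ω i j) μ
    rw [h.unit_variance, mul_one] at this
    simpa only [mul_comm (x j)] using this
  simp only [hvar] at hv
  have hsum : (∑ j, fun ω => A ω i j * x j) = fun ω => A ω i ⬝ᵥ x := by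
    ext ω
    simp [dotProduct]
  rw [hsum] at hv
  have hmean : ∫ ω, A ω i ⬝ᵥ x ∂μ = 0 := by
    simp only [dotProduct]
    rw [integral_finsetSum _ fun j _ => (hm j).integrable (by norm_num)]
    refine Finset.sum_eq_zero fun j _ => ?_
    rw [integral_mul_const, h.mean_zero, zero_mul]
  rw [← hv, variance_of_integral_eq_zero (h.measurable_dotProduct x i).aemeasurable hmean]

end IsSubGaussianEnsemble

/-! ### Norms, the radius of the dual ball, and `K ≥ 1` -/

lemma ellNorm_ofReal {m : ℕ} {p : ℝ} (hp : 0 < p) (z : Fin m → ℝ) :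
    ellNorm (ENNReal.ofReal p) z = (∑ i, |z i| ^ p) ^ (1 / p) := by
  have h : (ENNReal.ofReal p).toReal = p := ENNReal.toReal_ofReal hp.le
  rw [ellNorm, PiLp.norm_eq_sum (by rwa [h]), h]
  rfl

lemma ellNorm_two {m : ℕ} (z : Fin m → ℝ) : ellNorm 2 z = Real.sqrt (∑ i, z i ^ 2) := by
  rw [ellNorm, EuclideanSpace.norm_eq]
  simp

/-- Witnessed by a coordinate vector, which has norm 1 in every `ℓ_q`. -/
lemma one_le_rad {m : ℕ} [NeZero m] {q : ℝ≥0∞} (hq : 1 ≤ q) : 1 ≤ rad (ellBall q m) := by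
  have : Fact (1 ≤ q) := ⟨hq⟩
  have hmem : (Pi.single 0 1 : Fin m → ℝ) ∈ ellBall q m := by
    change ‖(PiLp.single q 0 1 : PiLp q fun _ : Fin m => ℝ)‖ ≤ 1
    rw [PiLp.norm_single]
    simp
  refine le_trans (le_of_eq ?_) (le_iSup₂ (f := fun y _ => ENNReal.ofReal (ellNorm 2 y)) _ hmem)
  change 1 = ENNReal.ofReal ‖(PiLp.single 2 0 1 : PiLp 2 fun _ : Fin m => ℝ)‖
  rw [PiLp.norm_single]
  simp

/-- Witnessed by the constant vector with entries `m^(1/p - 1) = m^(-1/q)`: it lies in the ball and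
has `ℓ₂` norm `m^(1/p - 1/2)`. -/
lemma rpow_le_rad {m : ℕ} [NeZero m] {p : ℝ} (hp : 1 ≤ p) {q : ℝ≥0∞}
    (hpq : ENNReal.HolderConjugate (ENNReal.ofReal p) q) :
    ENNReal.ofReal ((m : ℝ) ^ (1 / p - 1 / 2)) ≤ rad (ellBall q m) := by
  have hm : (0 : ℝ) < m := by exact_mod_cast NeZero.pos m
  have hm1 : (1 : ℝ) ≤ m := by exact_mod_cast NeZero.one_le
  have hp0 : 0 < p := by linarith
  have ha0 : 0 < (m : ℝ) ^ (1 / p - 1) := by positivity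
  have hmem : (fun _ => (m : ℝ) ^ (1 / p - 1) : Fin m → ℝ) ∈ ellBall q m := by
    change ellNorm q (fun _ => (m : ℝ) ^ (1 / p - 1)) ≤ 1
    rcases eq_or_ne q ∞ with rfl | hq
    · rw [ellNorm, PiLp.norm_toLp, pi_norm_le_iff_of_nonneg zero_le_one]
      intro i
      rw [Real.norm_of_nonneg ha0.le]
      refine Real.rpow_le_one_of_one_le_of_nonpos hm1 ?_
      rw [sub_nonpos, div_le_one hp0]
      exact hp
    · have hconj : (ENNReal.ofReal p).toReal.HolderConjugate q.toReal :=
        ENNReal.HolderConjugate.toReal_of_ne_top ENNReal.ofReal_ne_top hq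
      rw [ENNReal.toReal_ofReal hp0.le] at hconj
      have hq0 : 0 < q.toReal := hconj.symm.pos
      have hinv := hconj.inv_add_inv_eq_one
      have hqq : ellNorm q (fun _ : Fin m => (m : ℝ) ^ (1 / p - 1)) =
          (∑ _i : Fin m, |(m : ℝ) ^ (1 / p - 1)| ^ q.toReal) ^ (1 / q.toReal) := by
        have := ellNorm_ofReal hq0 (fun _ : Fin m => (m : ℝ) ^ (1 / p - 1))
        rwa [ENNReal.ofReal_toReal hq] at this
      rw [hqq, Finset.sum_const, Finset.card_univ, Fintype.card_fin, nsmul_eq_mul,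
        abs_of_pos ha0, ← Real.rpow_mul hm.le]
      have : (1 / p - 1) * q.toReal = -1 := by
        have h1 : 1 / p - 1 = -(q.toReal)⁻¹ := by rw [one_div]; linarith
        rw [h1, neg_mul, inv_mul_cancel₀ hq0.ne']
      rw [this, Real.rpow_neg_one, mul_inv_cancel₀ hm.ne', Real.one_rpow]
  refine le_trans (le_of_eq ?_) (le_iSup₂ (f := fun y _ => ENNReal.ofReal (ellNorm 2 y)) _ hmem)
  rw [ellNorm_two]
  congr 1
  simp only [Finset.sum_const, Finset.card_univ, Fintype.card_fin, nsmul_eq_mul]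
  rw [Real.sqrt_mul hm.le, Real.sqrt_sq ha0.le, Real.sqrt_eq_rpow, ← Real.rpow_add hm]
  congr 1
  ring

lemma orliczNorm_zero [IsProbabilityMeasure μ] : orliczNorm 2 (fun _ : Ω => (0 : ℝ)) μ = 0 := by
  have h : ∀ t : ℝ, 0 < t → orliczNorm 2 (fun _ : Ω => (0 : ℝ)) μ ≤ ENNReal.ofReal t :=
    fun t ht => HasPsiTwoBound.orliczNorm_le ht (by fun_prop) ⟨by simp, by simp⟩
  refine le_antisymm (ENNReal.le_of_forall_pos_le_add fun ε hε _ => ?_) zero_le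
  simpa using h ε hε

/-- A sub-Gaussian variable of unit variance has `ψ₂` norm at least one. -/
lemma one_le_orliczNorm [IsProbabilityMeasure μ] {X : Ω → ℝ} (hX : AEMeasurable X μ)
    (h0 : ∫ ω, X ω ∂μ = 0) (h1 : variance X μ = 1) : 1 ≤ orliczNorm 2 X μ := by
  refine le_sInf ?_
  rintro s ⟨t, ht, rfl, hle⟩
  simp only [abs_rpow_two_div] at hle
  have hpsi := (hasPsiTwoBound_iff_lintegral hX).2 hle
  have hsq := hpsi.integral_sq_le ht hX
  rw [← variance_of_integral_eq_zero hX h0, h1] at hsq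
  rw [← ENNReal.ofReal_one]
  exact ENNReal.ofReal_le_ofReal (by nlinarith)

lemma measurable_ellNorm_mulVec {m n : ℕ} {A : Ω → Matrix (Fin m) (Fin n) ℝ} {p : ℝ}
    (h : IsSubGaussianEnsemble A μ) (hp : 1 ≤ p) (x : Fin n → ℝ) :
    Measurable fun ω => ellNorm (ENNReal.ofReal p) (A ω *ᵥ x) := by
  have hm := h.measurable_dotProduct x
  have : ∀ ω, ellNorm (ENNReal.ofReal p) (A ω *ᵥ x) = (∑ i, |A ω i ⬝ᵥ x| ^ p) ^ (1 / p) :=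
    fun ω => ellNorm_ofReal (by linarith) _
  simp_rw [this]
  fun_prop

/-! ### The processes `R_x` and `X_x` -/

section Deviation

variable {m n : ℕ} [NeZero m] {A : Ω → Matrix (Fin m) (Fin n) ℝ}
  {p : ℝ} {x : Fin n → ℝ}

/-- The variables `|⟨A i, x⟩| / L` form a normalized family. -/
lemma IsSubGaussianEnsemble.isNormalizedFamily (h : IsSubGaussianEnsemble A μ) (hp : 1 ≤ p)
    {L : ℝ} (hL : 0 < L)
    (hpsi : ∀ i, HasPsiTwoBound (fun ω => A ω i ⬝ᵥ x) L μ) :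
    IsNormalizedFamily (fun i ω => |A ω i ⬝ᵥ x| / L) p (rowNorm p A μ x / L) μ where
  measurable i := by
    have := h.measurable_dotProduct x i
    fun_prop
  nonneg i ω := by positivity
  indep := (h.iIndepFun_dotProduct x).comp (fun _ y => |y| / L) fun _ => by fun_prop
  integrable_exp i := by simpa only [div_pow, sq_abs] using (hpsi i).integrable
  integral_exp_le i := by simpa only [div_pow, sq_abs] using (hpsi i).integral_le
  integral_rpow i := by
    have hnn : 0 ≤ ∫ ω, |A ω 0 ⬝ᵥ x| ^ p ∂μ := integral_nonneg fun ω => by positivity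
    have hid : ∫ ω, |A ω i ⬝ᵥ x| ^ p ∂μ = ∫ ω, |A ω 0 ⬝ᵥ x| ^ p ∂μ :=
      ((h.identDistrib_dotProduct x i 0).comp (u := fun y => |y| ^ p) (by fun_prop)).integral_eq
    rw [Real.div_rpow (by rw [rowNorm]; positivity) hL.le, rowNorm, rpow_one_div_rpow_self hnn hp,
      ← hid, ← integral_div]
    refine integral_congr_ae (Filter.Eventually.of_forall fun ω => ?_)
    exact Real.div_rpow (abs_nonneg _) hL.le p

lemma processR_eq (hp : 1 ≤ p) {L : ℝ} (hL : 0 < L) (ω : Ω) :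
    processR p A μ x ω = L * ((∑ i, (|A ω i ⬝ᵥ x| / L) ^ p) ^ (1 / p) -
      (m : ℝ) ^ (1 / p) * (rowNorm p A μ x / L)) := by
  have h1 : ∑ i, (|A ω i ⬝ᵥ x| / L) ^ p = (∑ i, |A ω i ⬝ᵥ x| ^ p) / L ^ p := by
    rw [Finset.sum_div]
    exact Finset.sum_congr rfl fun i _ => Real.div_rpow (abs_nonneg _) hL.le p
  have h2 : (∑ i, (|A ω i ⬝ᵥ x| / L) ^ p) ^ (1 / p) = (∑ i, |A ω i ⬝ᵥ x| ^ p) ^ (1 / p) / L := by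
    rw [h1, Real.div_rpow (Finset.sum_nonneg fun i _ => by positivity) (by positivity),
      ← Real.rpow_mul hL.le, mul_one_div_cancel (by linarith), Real.rpow_one]
  rw [processR, ellNorm_ofReal (by linarith), h2]
  change (∑ i, |A ω i ⬝ᵥ x| ^ p) ^ (1 / p) - _ = _
  field_simp

/-- Unit variance makes the second moment of the row product exactly `E²`. The first-moment bound
with `L = 4kE`, followed by Jensen, then leaves a quantity depending on `k` alone. -/
lemma le_rowNorm_div [IsProbabilityMeasure μ] (h : IsSubGaussianEnsemble A μ) (hp : 1 ≤ p) {k E : ℝ} (hk : 0 < k)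
    (hE : 0 < E) (hx : ∑ j, x j ^ 2 = E ^ 2)
    (hA : ∀ i j, HasPsiTwoBound (fun ω => A ω i j) k μ)
    (hYp : Integrable (fun ω => |A ω 0 ⬝ᵥ x| ^ p) μ) :
    1 / (6 * (4 * k) ^ 3) ≤ rowNorm p A μ x / (4 * k * E) := by
  have hL : 0 < 4 * k * E := by positivity
  have hY := (h.measurable_dotProduct x 0).aemeasurable (μ := μ)
  have hpsi := h.hasPsiTwoBound_dotProduct hk hA hE hx 0
  have h2 : ∫ ω, (A ω 0 ⬝ᵥ x) ^ 2 ∂μ = E ^ 2 := by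
    rw [← hx]
    exact h.integral_dotProduct_sq (fun i j => (hA i j).memLp_two hk
      (h.measurable i j).aemeasurable) x 0
  have h3 := hpsi.le_integral_abs hL hE hY h2
  have h4 := integral_abs_le_rpow_integral hp ((hpsi.memLp_two hL hY).integrable (by norm_num)) hYp
  have h5 : E ^ 3 / (6 * (4 * k * E) ^ 2) ≤ rowNorm p A μ x := h3.trans h4
  rw [le_div_iff₀ hL]
  refine le_trans (le_of_eq ?_) h5
  field_simp

lemma hasPsiTwoBound_processR [IsProbabilityMeasure μ] (h : IsSubGaussianEnsemble A μ)
    (hp : 1 ≤ p) {k E B c r : ℝ}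
    (hk : 1 ≤ k) (hE : 0 < E) (hx : ∑ j, x j ^ 2 = E ^ 2)
    (hA : ∀ i j, HasPsiTwoBound (fun ω => A ω i j) k μ) (hB0 : 0 < B)
    (hB : ∀ w : ℝ, 0 ≤ w → w ^ (2 * p) ≤ B * Real.exp (w ^ 2 / 2))
    (hc0 : 0 < c) (hc : c ≤ 1 / 8) (hcB : c * (8 * B) ≤ 1)
    (hr1 : 1 ≤ r) (hr : (m : ℝ) ^ (1 / p - 1 / 2) ≤ r) :
    HasPsiTwoBound (processR p A μ x) (Real.sqrt (2 * (4 + 2 * B)) *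
      (4 * k * E * r * (6 * (4 * k) ^ 3) ^ (p - 1) / Real.sqrt (c / 2))) μ := by
  have hk0 : 0 < k := by linarith
  have hL : 0 < 4 * k * E := by positivity
  have hfam := h.isNormalizedFamily hp hL fun i => h.hasPsiTwoBound_dotProduct hk0 hA hE hx i
  have hYp : Integrable (fun ω => |A ω 0 ⬝ᵥ x| ^ p) μ := by
    refine ((hfam.integrable_rpow hp hB 0).mul_const ((4 * k * E) ^ p)).congr
      (Filter.Eventually.of_forall fun ω => ?_)
    simp only
    rw [Real.div_rpow (abs_nonneg _) hL.le]
    field_simp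
  have hs := le_rowNorm_div h hp hk0 hE hx hA hYp
  have hG : 1 ≤ 6 * (4 * k) ^ 3 := by
    have : 1 ≤ (4 * k) ^ 3 := one_le_pow₀ (by linarith)
    linarith
  have hG0 : 0 < 6 * (4 * k) ^ 3 := by linarith
  have hs0 : 0 ≤ rowNorm p A μ x / (4 * k * E) := le_trans (by positivity) hs
  have hGp : 0 < (6 * (4 * k) ^ 3) ^ (p - 1) := by positivity
  have hδ : (1 / (6 * (4 * k) ^ 3)) ^ (p - 1) ≤ (rowNorm p A μ x / (4 * k * E)) ^ (p - 1) :=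
    Real.rpow_le_rpow (by positivity) hs (by linarith)
  have hδ1 : (1 / (6 * (4 * k) ^ 3)) ^ (p - 1) ≤ 1 :=
    Real.rpow_le_one (by positivity) (by rw [div_le_one hG0]; exact hG) (by linarith)
  have hδeq : (1 / (6 * (4 * k) ^ 3)) ^ (p - 1) = 1 / (6 * (4 * k) ^ 3) ^ (p - 1) := by
    rw [Real.div_rpow zero_le_one hG0.le, Real.one_rpow]
  have hsc : 0 < Real.sqrt (c / 2) := Real.sqrt_pos.2 (by linarith)
  have hscq : Real.sqrt (c / 2) ^ 2 = c / 2 := Real.sq_sqrt (by linarith)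
  refine hasPsiTwoBound_of_tail (by linarith) (by positivity)
    ((measurable_ellNorm_mulVec h hp x).sub_const _) fun t ht => ?_
  -- Here `δ = G^(-(p-1))` with `G = 6(4k)³`. The deviation is rescaled by `G^(p-1)/√(c/2)` so that
  -- the exponent becomes exactly `-t²`.
  have htail := hfam.measure_abs_sub_ge_le (NeZero.pos m) hp hs0 hB0 hB hc0 hc hcB (by positivity)
    hδ1 hδ hr1 hr (t := t * (6 * (4 * k) ^ 3) ^ (p - 1) / Real.sqrt (c / 2)) (by positivity)
  have hexp : c / 2 * ((1 / (6 * (4 * k) ^ 3)) ^ (p - 1) *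
      (t * (6 * (4 * k) ^ 3) ^ (p - 1) / Real.sqrt (c / 2))) ^ 2 = t ^ 2 := by
    rw [hδeq]
    have : 1 / (6 * (4 * k) ^ 3) ^ (p - 1) * (t * (6 * (4 * k) ^ 3) ^ (p - 1) / Real.sqrt (c / 2)) =
        t / Real.sqrt (c / 2) := by
      generalize (6 * (4 * k) ^ 3) ^ (p - 1) = G at hGp
      field_simp
    rw [this, div_pow, hscq]
    field_simp
  rw [hexp] at htail
  refine le_trans (measureReal_mono fun ω hω => ?_) htail
  simp only [Set.mem_ofPred_eq] at hω ⊢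
  rw [processR_eq hp hL, abs_mul, abs_of_pos hL] at hω
  refine le_of_mul_le_mul_left (le_trans (le_of_eq ?_) hω) hL
  ring

end Deviation

lemma HasPsiTwoBound.processX [IsProbabilityMeasure μ] {m n : ℕ} [NeZero m]
    {A : Ω → Matrix (Fin m) (Fin n) ℝ} {p : ℝ} {x : Fin n → ℝ} (h : IsSubGaussianEnsemble A μ)
    (hp : 1 ≤ p) {T : ℝ} (hT : 0 < T) (hR : HasPsiTwoBound (processR p A μ x) T μ) :
    HasPsiTwoBound (MatrixDeviation.processX p A μ x) (3 * T) μ := by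
  have hRm : Measurable (processR p A μ x) := (measurable_ellNorm_mulVec h hp x).sub_const _
  have hRi : Integrable (processR p A μ x) μ :=
    (hR.memLp_two hT hRm.aemeasurable).integrable (by norm_num)
  have heq : ∫ ω, ellNorm (ENNReal.ofReal p) (A ω *ᵥ x) ∂μ =
      ∫ ω, processR p A μ x ω ∂μ + (m : ℝ) ^ (1 / p) * rowNorm p A μ x := by
    have : ∀ ω, ellNorm (ENNReal.ofReal p) (A ω *ᵥ x) =
        processR p A μ x ω + (m : ℝ) ^ (1 / p) * rowNorm p A μ x := fun ω => by
      rw [processR, sub_add_cancel]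
    simp_rw [this]
    rw [integral_add hRi (integrable_const _)]
    simp
  have hfun : MatrixDeviation.processX p A μ x =
      fun ω => processR p A μ x ω - ∫ ω', processR p A μ x ω' ∂μ := by
    ext ω
    rw [MatrixDeviation.processX, heq, processR]
    ring
  rw [hfun]
  exact hR.sub_integral hT hRm.aemeasurable

/-- The case `x = 0` is separate because the normalizing scale `4kE` vanishes there. -/
lemma orliczNorm_process_eq_zero [IsProbabilityMeasure μ] {m n : ℕ} [NeZero m]
    {A : Ω → Matrix (Fin m) (Fin n) ℝ} {p : ℝ} (hp : 1 ≤ p) :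
    orliczNorm 2 (processR p A μ 0) μ = 0 ∧
      orliczNorm 2 (MatrixDeviation.processX p A μ 0) μ = 0 := by
  have hp0 : p ≠ 0 := by linarith
  have h0 : ellNorm (ENNReal.ofReal p) (0 : Fin m → ℝ) = 0 := by
    rw [ellNorm_ofReal (by linarith)]
    simp [Real.zero_rpow hp0, hp0]
  have hR : processR p A μ 0 = fun _ => 0 := by
    ext ω
    simp [processR, rowNorm, h0, Real.zero_rpow hp0, hp0]
  have hX : MatrixDeviation.processX p A μ 0 = fun _ => 0 := by
    ext ω
    simp [MatrixDeviation.processX, h0]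
  rw [hR, hX]
  exact ⟨orliczNorm_zero, orliczNorm_zero⟩

end MatrixDeviation

/-- With `k = 2k₀`, the base is `6 · 8³ = 3072` times `k₀³`. The total power `k₀^(1 + 3(p-1))` is at
most `k₀^(4p)` because `k₀ ≥ 1`. -/
lemma MatrixDeviation.psiTwoBound_constant_le {p k₀ E r D : ℝ} (hp : 1 ≤ p) (hk : 1 ≤ k₀)
    (hE : 0 < E) (hr : 0 < r) (hD : 0 < D) :
    D * (4 * (2 * k₀) * E * r * (6 * (4 * (2 * k₀)) ^ 3) ^ (p - 1)) ≤
      D * 8 * 3072 ^ (p - 1) * k₀ ^ (4 * p) * r * E := by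
  have hk0 : 0 < k₀ := by linarith
  have h1 : (6 * (4 * (2 * k₀)) ^ 3) ^ (p - 1) = 3072 ^ (p - 1) * k₀ ^ (3 * (p - 1)) := by
    rw [show 6 * (4 * (2 * k₀)) ^ 3 = 3072 * k₀ ^ (3 : ℝ) by
      rw [show (3 : ℝ) = (3 : ℕ) by norm_num, Real.rpow_natCast]; ring,
      Real.mul_rpow (by norm_num) (by positivity), ← Real.rpow_mul hk0.le]
  have h2 : k₀ * k₀ ^ (3 * (p - 1)) ≤ k₀ ^ (4 * p) := by
    rw [mul_comm, ← Real.rpow_add_one hk0.ne']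
    exact Real.rpow_le_rpow_of_exponent_le hk (by linarith)
  rw [h1]
  calc D * (4 * (2 * k₀) * E * r * (3072 ^ (p - 1) * k₀ ^ (3 * (p - 1))))
      = D * 8 * 3072 ^ (p - 1) * (k₀ * k₀ ^ (3 * (p - 1))) * r * E := by ring
    _ ≤ _ := by gcongr

theorem theorem3p3 (p : ℝ) (hp : 1 ≤ p) (q : ℝ≥0∞)
    (hpq : ENNReal.HolderConjugate (ENNReal.ofReal p) q) :
    ∃ C : ℝ≥0, 0 < C ∧
      ∀ (Ω : Type*) [MeasurableSpace Ω] (μ : Measure Ω) [IsProbabilityMeasure μ]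
        (m n : ℕ) [NeZero m] [NeZero n] (A : Ω → Matrix (Fin m) (Fin n) ℝ),
        MatrixDeviation.IsSubGaussianEnsemble A μ →
        ∀ (K : ℝ≥0∞), K = MatrixDeviation.orliczNorm 2 (fun ω => A ω 0 0) μ →
        ∀ x : Fin n → ℝ,
          MatrixDeviation.orliczNorm 2 (MatrixDeviation.processR p A μ x) μ ≤
              C * K ^ (4 * p) * MatrixDeviation.rad (MatrixDeviation.ellBall q m) *
                ENNReal.ofReal (MatrixDeviation.ellNorm 2 x) ∧
          MatrixDeviation.orliczNorm 2 (MatrixDeviation.processX p A μ x) μ ≤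
              C * K ^ (4 * p) * MatrixDeviation.rad (MatrixDeviation.ellBall q m) *
                ENNReal.ofReal (MatrixDeviation.ellNorm 2 x) := by
  obtain ⟨B, hB0, hB'⟩ := MatrixDeviation.exists_rpow_le_mul_exp_sq (a := 2 * p) (c := 1 / 2)
    (by linarith) (by norm_num)
  have hB : ∀ w : ℝ, 0 ≤ w → w ^ (2 * p) ≤ B * Real.exp (w ^ 2 / 2) := fun w hw => by
    have := hB' w hw
    rwa [one_div_mul_eq_div] at this
  -- The bound `1/8` keeps the Chernoff parameters admissible; `8Bc ≤ 1` makes the quadratic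
  -- Chernoff term at most half the linear one.
  obtain ⟨c, hc⟩ : ∃ c, c = min (1 / 8) (1 / (8 * B)) := ⟨_, rfl⟩
  have hc0 : 0 < c := by rw [hc]; positivity
  have hc8 : c ≤ 1 / 8 := hc ▸ min_le_left _ _
  have hcB : c * (8 * B) ≤ 1 := by
    rw [← le_div_iff₀ (by positivity)]
    exact hc ▸ min_le_right _ _
  obtain ⟨D, hD⟩ : ∃ D, D = Real.sqrt (2 * (4 + 2 * B)) / Real.sqrt (c / 2) := ⟨_, rfl⟩
  have hD0 : 0 < D := by rw [hD]; positivity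
  have hC0 : 0 < 3 * (D * 8 * 3072 ^ (p - 1)) := by positivity
  -- The factor 3 is the cost of centering, so one constant serves both processes.
  refine ⟨Real.toNNReal (3 * (D * 8 * 3072 ^ (p - 1))), Real.toNNReal_pos.2 hC0, ?_⟩
  intro Ω _ μ _ m n _ _ A hA K hK x
  rcases eq_or_ne x 0 with rfl | hx0
  · have h := MatrixDeviation.orliczNorm_process_eq_zero (μ := μ) (A := A) hp
    rw [h.1, h.2]
    exact ⟨zero_le, zero_le⟩
  have hKtop : K ≠ ∞ := hK ▸ (hA.subGaussian 0 0).ne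
  have hK1 : 1 ≤ K := hK ▸ MatrixDeviation.one_le_orliczNorm (hA.measurable 0 0).aemeasurable
    (hA.mean_zero 0 0) (hA.unit_variance 0 0)
  obtain ⟨k₀, hk₀⟩ : ∃ k₀, k₀ = K.toReal := ⟨_, rfl⟩
  have hKk : K = ENNReal.ofReal k₀ := by rw [hk₀, ENNReal.ofReal_toReal hKtop]
  have hk1 : 1 ≤ k₀ := by
    rw [hKk, ← ENNReal.ofReal_one] at hK1
    exact (ENNReal.ofReal_le_ofReal_iff' .. |>.1 hK1).resolve_right (by norm_num)
  have hk0 : 0 < k₀ := by linarith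
  have hpsi : ∀ i j, MatrixDeviation.HasPsiTwoBound (fun ω => A ω i j) (2 * k₀) μ := fun i j => by
    refine MatrixDeviation.hasPsiTwoBound_of_identDistrib (hA.identDistrib 0 0 i j)
      (MatrixDeviation.hasPsiTwoBound_of_orliczNorm_lt (hA.measurable 0 0).aemeasurable ?_)
    rw [← hK, hKk, ENNReal.ofReal_lt_ofReal_iff (by linarith)]
    linarith
  obtain ⟨E, hE⟩ : ∃ E, E = MatrixDeviation.ellNorm 2 x := ⟨_, rfl⟩
  have hxE : ∑ j, x j ^ 2 = E ^ 2 := by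
    rw [hE, MatrixDeviation.ellNorm_two, Real.sq_sqrt (Finset.sum_nonneg fun j _ => sq_nonneg _)]
  have hE0 : 0 < E := by
    obtain ⟨j, hj⟩ := Function.ne_iff.1 hx0
    rw [hE, MatrixDeviation.ellNorm_two, Real.sqrt_pos]
    exact Finset.sum_pos' (fun j _ => sq_nonneg _) ⟨j, Finset.mem_univ _, by
      have : x j ≠ 0 := hj
      positivity⟩
  obtain ⟨r, hr⟩ : ∃ r, r = max 1 ((m : ℝ) ^ (1 / p - 1 / 2)) := ⟨_, rfl⟩
  have hr1 : 1 ≤ r := hr ▸ le_max_left _ _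
  have hrad : ENNReal.ofReal r ≤ MatrixDeviation.rad (MatrixDeviation.ellBall q m) := by
    rw [hr, ENNReal.ofReal_max]
    refine max_le ?_ (MatrixDeviation.rpow_le_rad hp hpq)
    rw [ENNReal.ofReal_one]
    exact MatrixDeviation.one_le_rad (ENNReal.HolderConjugate.one_le q (ENNReal.ofReal p))
  have hR := MatrixDeviation.hasPsiTwoBound_processR hA hp (by linarith : 1 ≤ 2 * k₀) hE0 hxE hpsi
    hB0 hB hc0 hc8 hcB hr1 (hr ▸ le_max_right _ _)
  obtain ⟨T, hT⟩ : ∃ T, T = D * (4 * (2 * k₀) * E * r * (6 * (4 * (2 * k₀)) ^ 3) ^ (p - 1)) :=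
    ⟨_, rfl⟩
  have hT0 : 0 < T := by rw [hT]; positivity
  have hTR : MatrixDeviation.HasPsiTwoBound (MatrixDeviation.processR p A μ x) T μ := by
    convert hR using 1
    rw [hT, hD]
    ring
  have hTle : 3 * T ≤ 3 * (D * 8 * 3072 ^ (p - 1)) * k₀ ^ (4 * p) * r * E := by
    have := MatrixDeviation.psiTwoBound_constant_le hp hk1 hE0 (by linarith : 0 < r) hD0
    rw [← hT] at this
    linarith
  have hfinal : ENNReal.ofReal (3 * T) ≤
      Real.toNNReal (3 * (D * 8 * 3072 ^ (p - 1))) * K ^ (4 * p) *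
        MatrixDeviation.rad (MatrixDeviation.ellBall q m) *
        ENNReal.ofReal (MatrixDeviation.ellNorm 2 x) := by
    refine (ENNReal.ofReal_le_ofReal hTle).trans ?_
    rw [ENNReal.ofReal_mul (by positivity), ENNReal.ofReal_mul (by positivity),
      ENNReal.ofReal_mul hC0.le, ← ENNReal.ofReal_rpow_of_pos hk0, ← hKk, ← hE]
    change (Real.toNNReal (3 * (D * 8 * 3072 ^ (p - 1))) : ℝ≥0∞) * K ^ (4 * p) *
      ENNReal.ofReal r * ENNReal.ofReal E ≤ _
    gcongr
  have hRm : Measurable (MatrixDeviation.processR p A μ x) :=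
    (MatrixDeviation.measurable_ellNorm_mulVec hA hp x).sub_const _
  have hXm : Measurable (MatrixDeviation.processX p A μ x) :=
    (MatrixDeviation.measurable_ellNorm_mulVec hA hp x).sub_const _
  exact ⟨((hTR.orliczNorm_le hT0 hRm.aemeasurable).trans
      (ENNReal.ofReal_le_ofReal (by linarith))).trans hfinal,
    ((hTR.processX hA hp hT0).orliczNorm_le (by linarith) hXm.aemeasurable).trans hfinal⟩
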